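/- **Theorem B.** Work in the projective plane $\mathbb{P}^2_K$, $K=\mathbb{R}$ or $\mathbb{C}$. For an arrangement $\mathcal{L}$ of lines, a point has multiplicity $k$ if exactly $k$ lines of $\mathcal{L}$ pass through it, and $n_k=n_k(\mathcal{L})$ denotes the number of points of multiplicity $k$ ($k\ge 2$). Let $\Lambda_{\{2\},3}(\mathcal{L})$ be the arrangement of all lines of the plane that contain at least three double points (points of multiplicity exactly $2$) of $\mathcal{L}$. Let $\mathcal{C}_8$ be the arrangement of the $8$ lines spanned by the sides of the regular octagon with vertices $(\cos\frac{k\pi}{4},\sin\frac{k\pi}{4})$, $0\le k\le 7$, in the chart $z=1$ of $\mathbb{P}^2_{\mathbb{R}}$. Then $\mathcal{O}_{33}=\Lambda_{\{2\},3}(\mathcal{C}_8)$, computed in $\mathbb{P}^2_{\mathbb{R}}$ or equivalently in $\mathbb{P}^2_{\mathbb{C}}$, is an arrangement of $33$ real lines with $$n_2=108,\quad n_3=40,\quad n_5=16,\quad n_8=5,$$ and $n_k=0$ for all other $k\ge 2$. Moreover: (i) $\mathcal{O}_{33}$ is rigid: the moduli space of complex line arrangements with the same incidences is zero-dimensional.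 This moduli space is the set of families of $33$ vectors in $\mathbb{C}^3$, indexed by the lines of $\mathcal{O}_{33}$, in which three vectors are linearly independent exactly when the corresponding three lines of $\mathcal{O}_{33}$ are not concurrent, with its Zariski topology, modulo the action of $\mathrm{GL}_3(\mathbb{C})$ and rescaling of the single vectors. (ii) $\mathcal{O}_{33}$ is free with exponents $(15,17)$: if $f\in S=\mathbb{C}[x,y,z]$ is the product of linear equations of the $33$ lines and $J_f=\langle\partial_xf,\partial_yf,\partial_zf\rangle$, then $f$ is reduced and $S/J_f$ has a minimal graded free resolution $$0\to S(-32-15)\oplus S(-32-17)\to S^3(-32)\to S\to S/J_f\to 0.$$ -/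

import Mathlib

open scoped LinearAlgebra.Projectivization

noncomputable section

namespace LineArrangement

/-- The projective plane over `K` in homogeneous coordinates. The same type is used for the dual
plane: the line `a x + b y + c z = 0` is given by its coefficient vector `(a : b : c)`, and a line
`l` contains a point `p` when `l.orthogonal p`, that is `a x + b y + c z = 0`. With this coding the
dual operator between the plane and the dual plane is the identity on coordinates. -/
abbrev Plane (K : Type*) [Field K] : Type _ := ℙ K (Fin 3 → K)

section Operators

variable {K : Type*} [Field K]

/-- For a set `L` of lines (equivalently, of points of the dual plane) and a set `N` of integers:
the set of all lines of the dual plane that contain exactly `n` of the points dual to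
the lines of `L`, for some `n ∈ N`. Equivalently, the set of all points of the plane through which
exactly `n` lines of `L` pass, for some `n ∈ N`. -/
def dualOp (N : Set ℕ) (L : Set (Plane K)) : Set (Plane K) :=
  {p | ∃ n ∈ N, {l ∈ L | l.orthogonal p}.encard = (n : ℕ∞)}

/-- The point-line operator: the set of lines that contain exactly `m` points (for some `m ∈ M`)
among the points of multiplicity in `N` of the line arrangement `L`. -/
def pointLineOp (N M : Set ℕ) (L : Set (Plane K)) : Set (Plane K) :=
  dualOp M (dualOp N L)

/-- The number `n_k` of points of the plane through which exactly `k` lines of `L` pass. -/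
def numPoints (L : Set (Plane K)) (k : ℕ) : ℕ∞ :=
  {p : Plane K | {l ∈ L | l.orthogonal p}.encard = (k : ℕ∞)}.encard

end Operators

section Octagon

/-- The point `(cos (2πk/n), sin (2πk/n))` of the affine chart `z = 1` of the real plane. -/
def polygonVertex (n k : ℕ) : Plane ℝ :=
  Projectivization.mk ℝ
    ![Real.cos (2 * Real.pi * k / n), Real.sin (2 * Real.pi * k / n), 1]
    (fun h => one_ne_zero (congrFun h 2))

/-- The lines spanned by the sides of the regular `n`-gon inscribed in the unit circle. -/
def polygonLines (n : ℕ) : Set (Plane ℝ) :=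
  {l | ∃ k < n, l.orthogonal (polygonVertex n k) ∧ l.orthogonal (polygonVertex n (k + 1))}

/-- The inclusion `ℝ³ → ℂ³`. -/
def complexVec : (Fin 3 → ℝ) →ₛₗ[algebraMap ℝ ℂ] (Fin 3 → ℂ) where
  toFun v i := (v i : ℂ)
  map_add' v w := by ext i; simp
  map_smul' c v := by ext i; simp

lemma complexVec_injective : Function.Injective complexVec := fun v w h => by
  ext i
  exact Complex.ofReal_injective (congrFun h i)

/-- A real line arrangement, regarded as an arrangement in the complex projective plane. -/
def complexify (L : Set (Plane ℝ)) : Set (Plane ℂ) :=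
  Projectivization.map complexVec complexVec_injective '' L

end Octagon

section Freeness

variable {K : Type*} [Field K]

/-- The Jacobian ideal of a polynomial in three variables. -/
def jacobianIdeal (f : MvPolynomial (Fin 3) K) : Ideal (MvPolynomial (Fin 3) K) :=
  Ideal.span (Set.range fun i => MvPolynomial.pderiv i f)

/-- The map `S³ → S` given by the three partial derivatives of `f`. -/
def jacobianMap (f : MvPolynomial (Fin 3) K) :
    (Fin 3 → MvPolynomial (Fin 3) K) →ₗ[MvPolynomial (Fin 3) K] MvPolynomial (Fin 3) K :=
  Fintype.linearCombination (MvPolynomial (Fin 3) K) (fun i => MvPolynomial.pderiv i f)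

/-- The curve `f = 0` is reduced, of degree `d`, and free with exponents `(d₁, d₂)`: one has
`d₁ + d₂ = d - 1`, and the Milnor algebra `M(f) = S / J_f` has the minimal graded free resolution
`0 → S(1-d-d₁) ⊕ S(1-d-d₂) → S³(1-d) → S → M(f) → 0`. That the first map is graded means that the
image of the `j`-th basis vector has entries homogeneous of degree `d_j`; the resolution is then
minimal because `1 ≤ d_j`. -/
structure IsFreeCurve (f : MvPolynomial (Fin 3) K) (d : ℕ) (e : Fin 2 → ℕ) : Prop where
  homogeneous : f.IsHomogeneous d
  ne_zero : f ≠ 0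
  reduced : Squarefree f
  one_le : 1 ≤ e 0
  le : e 0 ≤ e 1
  sum_eq : e 0 + e 1 + 1 = d
  resolution : ∃ φ : (Fin 2 → MvPolynomial (Fin 3) K) →ₗ[MvPolynomial (Fin 3) K]
      (Fin 3 → MvPolynomial (Fin 3) K),
    (∀ j i, (φ (Pi.single j 1) i).IsHomogeneous (e j)) ∧
    Function.Injective φ ∧
    Function.Exact φ (jacobianMap f) ∧
    Function.Exact (jacobianMap f) (Submodule.mkQ (jacobianIdeal f)) ∧
    Function.Surjective (Submodule.mkQ (jacobianIdeal f))

/-- The product of the linear forms of the lines of a finite arrangement (well defined up to a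
nonzero constant factor). -/
def definingPoly (L : Set (Plane K)) : MvPolynomial (Fin 3) K :=
  ∏ᶠ l ∈ L, ∑ i, MvPolynomial.C (l.rep i) * MvPolynomial.X i

/-- The finite arrangement `L` is free with exponents `(d₁, d₂)`. -/
def IsFree (L : Set (Plane K)) (d₁ d₂ : ℕ) : Prop :=
  L.Finite ∧ IsFreeCurve (definingPoly L) L.ncard ![d₁, d₂]

end Freeness

section Rigidity

variable {K : Type*} [Field K]

/-- A realization over `K` of the rank-three matroid of the line arrangement `L`: a matrix with one
column in `K³` for each line of `L`, such that a `3 × 3` minor is nonzero exactly when the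
corresponding three lines of `L` are linearly independent (that is, not concurrent). -/
structure Realization (L : Set (Plane K)) where
  col : L → Fin 3 → K
  det_ne_zero_iff : ∀ a b c : L,
    (Matrix.of ![col a, col b, col c]).det ≠ 0 ↔
      (Matrix.of ![a.1.rep, b.1.rep, c.1.rep]).det ≠ 0

/-- The Zariski topology on the realizations, as a subset of the affine space of matrices. -/
instance (L : Set (Plane K)) : TopologicalSpace (Realization L) :=
  TopologicalSpace.induced
    (fun X => (MvPolynomial.pointToPoint (fun p : L × Fin 3 => X.col p.1 p.2) :
      PrimeSpectrum (MvPolynomial (L × Fin 3) K))) inferInstance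

/-- Two realizations are equivalent when the line arrangements that they define are projectively
equivalent: one goes to the other by an element of `GL₃` and a rescaling of the columns. -/
instance realizationSetoid (L : Set (Plane K)) : Setoid (Realization L) where
  r X Y := ∃ (g : GL (Fin 3) K) (t : L → Kˣ), ∀ a, Y.col a = (t a : K) • g.1.mulVec (X.col a)
  iseqv :=
    { refl := fun X => ⟨1, 1, fun a => by simp⟩
      symm := by
        rintro X Y ⟨g, t, h⟩
        refine ⟨g⁻¹, t⁻¹, fun a => ?_⟩
        have hg : (g⁻¹).1 * g.1 = 1 := by rw [← Units.val_mul, inv_mul_cancel, Units.val_one]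
        rw [h a, Matrix.mulVec_smul, Matrix.mulVec_mulVec, hg, Matrix.one_mulVec, smul_smul]
        simp
      trans := by
        rintro X Y Z ⟨g, t, h⟩ ⟨g', t', h'⟩
        refine ⟨g' * g, t' * t, fun a => ?_⟩
        rw [h' a, h a, Matrix.mulVec_smul, Matrix.mulVec_mulVec, smul_smul]
        simp }

/-- The moduli space of line arrangements with the same incidences as `L`, with the quotient of the
Zariski topology. -/
abbrev ModuliSpace (L : Set (Plane K)) : Type _ := Quotient (realizationSetoid L)

/-- The moduli space of line arrangements with the same incidences as `L` is zero-dimensional. -/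
def IsRigid (L : Set (Plane K)) : Prop := topologicalKrullDim (ModuliSpace L) = 0

end Rigidity

end LineArrangement

end

/-!
The lines and points of the arrangement have coordinates in `ℤ[√2]`, so every incidence is an
identity in that ring. Incidences are therefore checked once, by evaluation, on lists of integral
vectors; they hold in the plane over any field `K` with an injective ring homomorphism `ℤ[√2] → K`,
in particular over `ℝ` and over `ℂ`. To find the points of given multiplicities at least two it is
enough to intersect the lines in pairs (`dualOp_points`). This gives the 33 lines
(`pointLineOp_octagonLines`) and the numbers of multiple points (`numPoints_lines33`).

*Freeness.* The 33 lines are the line at infinity, the eight axes of symmetry of the octagon, and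
the sides of three concentric octagons (`lines33_perm`). With `R = 2 (x² + y²)`, with `A`, `B` the
real and imaginary parts of `(x + i y)⁴`, and with `Q = 4 A²`, `t = (2 + √2) z²`, the axes have the
product `A B` and the sides of the octagons have the products `Q + m (m - R)² (m - 2 R)` for
`m = e t`, up to constants, where `e` runs through the roots of `(e - 1) (e² - 6 e + 1)`
(`prod_sides`). The derivations `a (x ∂ₓ + y ∂ᵧ) + 2 b B (A_y ∂ₓ - A_x ∂ᵧ)` with `a`, `b`
polynomials in `R`, `t`, `Q` are tangent to the axes and to the line at infinity, and tangency to an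
octagon is one congruence for `a` and `b`. Two such derivations, of degrees 15 and 17, satisfy the
congruences of all three octagons (`tangent₁`, `tangent₂`), and their determinant with the Euler
derivation is the product of all the lines, up to a constant (`det_terms`, `saitoDet_octTheta`).
Saito's criterion (`isFree_of_saito`), which is proved here for products of distinct linear forms,
shows that they give a basis of the syzygies of the Jacobian ideal.

*Rigidity.* Four of the lines are a projective frame. In the coordinates given by this frame, the
incidences determine all the other lines from the ratio `X : Y` of two coordinates of one further
line (`SameIncidences.eq_smul_eval`), and force `(X + Y)² = 2 Y²`
(`SameIncidences.exists_normal_form`). Every realization is hence projectively equivalent to the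
arrangement or to its conjugate under `√2 ↦ -√2`. The two cases are separated by the value of a
cross ratio, which is a condition closed in the Zariski topology, so the moduli space is discrete,
and it is not empty.
-/

namespace LineArrangement

/-! ### Integral coordinate vectors over `ℤ[√2]` -/

/-- A coordinate vector over `ℤ[√2]`; it stands for a line or a point of the plane over any field
that receives `ℤ[√2]`. A structure rather than a function on `Fin 3`, so that the incidence checks
below are evaluated quickly by the kernel. -/
@[ext] structure IntVec where
  x : ℤ√2
  y : ℤ√2
  z : ℤ√2
  deriving DecidableEq

namespace IntVec

/-- The dot product. -/
def dot (v w : IntVec) : ℤ√2 := v.x * w.x + v.y * w.y + v.z * w.z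

/-- The cross product. -/
def cross (v w : IntVec) : IntVec :=
  ⟨v.y * w.z - v.z * w.y, v.z * w.x - v.x * w.z, v.x * w.y - v.y * w.x⟩

/-- The zero vector, which stands for no point. -/
def zero : IntVec := ⟨0, 0, 0⟩

/-- The number of vectors of the list `A` that are orthogonal to `w`. -/
def mult (A : List IntVec) (w : IntVec) : ℕ := (A.filter fun v => dot v w = 0).length

section Eval

variable {K : Type*} [Field K] (φ : ℤ√2 →+* K)

/-- The vector of `K³` that an integral vector defines. -/
def eval (v : IntVec) : Fin 3 → K := ![φ v.x, φ v.y, φ v.z]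

lemma eval_dotProduct (v w : IntVec) : v.eval φ ⬝ᵥ w.eval φ = φ (dot v w) := by
  simp [eval, dot, dotProduct, Fin.sum_univ_three]

lemma eval_crossProduct (v w : IntVec) :
    crossProduct (v.eval φ) (w.eval φ) = (cross v w).eval φ := by
  ext i
  fin_cases i <;> simp [eval, cross, cross_apply]

lemma det_eval (u v w : IntVec) :
    (Matrix.of ![u.eval φ, v.eval φ, w.eval φ]).det = φ (dot u (cross v w)) := by
  rw [← eval_dotProduct, ← eval_crossProduct, triple_product_eq_det]
  rfl

variable {φ}

lemma eval_eq_zero_iff (hφ : Function.Injective φ) (v : IntVec) : v.eval φ = 0 ↔ v = zero := by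
  constructor
  · intro h
    have h0 := congrFun h 0
    have h1 := congrFun h 1
    have h2 := congrFun h 2
    simp only [eval, Matrix.cons_val, Pi.zero_apply, map_eq_zero_iff φ hφ] at h0 h1 h2
    ext1 <;> assumption
  · rintro rfl
    ext i
    fin_cases i <;> simp [eval, zero]

end Eval

end IntVec

open IntVec

/-! ### Arrangements with integral coordinates -/

section Points

variable {K : Type*} [Field K] {φ : ℤ√2 →+* K}

/-- Two points that are orthogonal to the same two independent vectors are equal. -/
lemma mk_eq_mk_of_orthogonal {a b p w : Fin 3 → K} (hab : crossProduct a b ≠ 0)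
    (hp : p ≠ 0) (hw : w ≠ 0) (hap : a ⬝ᵥ p = 0) (hbp : b ⬝ᵥ p = 0)
    (haw : a ⬝ᵥ w = 0) (hbw : b ⬝ᵥ w = 0) :
    Projectivization.mk K p hp = Projectivization.mk K w hw := by
  have key : ∀ q : Fin 3 → K, ∀ hq : q ≠ 0, a ⬝ᵥ q = 0 → b ⬝ᵥ q = 0 →
      Projectivization.mk K q hq = Projectivization.mk K _ hab := by
    intro q hq ha hb
    rw [Projectivization.mk_eq_mk_iff_crossProduct_eq_zero, ← cross_anticomm,
      cross_cross_eq_smul_sub_smul, ha, hb]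
    simp
  rw [key p hp hap hbp, key w hw haw hbw]

/-- The set of points (or of lines) of the projective plane over `K` that are given by the vectors
of the list `A`. -/
def points (φ : ℤ√2 →+* K) (A : List IntVec) : Set (Plane K) :=
  {p | ∃ v ∈ A, ∃ h : v.eval φ ≠ 0, Projectivization.mk K (v.eval φ) h = p}

/-- A list of nonzero, pairwise non-proportional vectors. -/
def Reduced (A : List IntVec) : Prop :=
  (∀ v ∈ A, v ≠ zero) ∧ A.Pairwise fun v w => cross v w ≠ zero

instance (A : List IntVec) : Decidable (Reduced A) := inferInstanceAs (Decidable (_ ∧ _))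

lemma Reduced.filter {A : List IntVec} (hA : Reduced A) (f : IntVec → Bool) :
    Reduced (A.filter f) :=
  ⟨fun v hv => hA.1 v (List.mem_of_mem_filter hv), hA.2.filter f⟩

lemma mk_eval_eq_iff (hφ : Function.Injective φ) {v w : IntVec} (hv : v.eval φ ≠ 0)
    (hw : w.eval φ ≠ 0) :
    Projectivization.mk K (v.eval φ) hv = Projectivization.mk K (w.eval φ) hw ↔
      cross v w = zero := by
  rw [Projectivization.mk_eq_mk_iff_crossProduct_eq_zero, eval_crossProduct, eval_eq_zero_iff hφ]

lemma points_cons (hφ : Function.Injective φ) {v : IntVec} {A : List IntVec}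
    (hA : Reduced (v :: A)) (hv : v.eval φ ≠ 0) :
    points φ (v :: A) = insert (Projectivization.mk K _ hv) (points φ A) ∧
      Projectivization.mk K _ hv ∉ points φ A := by
  constructor
  · ext p
    simp only [points, List.mem_cons, Set.mem_ofPred_eq, Set.mem_insert_iff]
    constructor
    · rintro ⟨w, rfl | hw, h, rfl⟩
      · exact Or.inl rfl
      · exact Or.inr ⟨w, hw, h, rfl⟩
    · rintro (rfl | ⟨w, hw, h, rfl⟩)
      · exact ⟨v, Or.inl rfl, hv, rfl⟩
      · exact ⟨w, Or.inr hw, h, rfl⟩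
  · rintro ⟨w, hw, h, hvw⟩
    exact (List.pairwise_cons.1 hA.2).1 w hw ((mk_eval_eq_iff hφ hv h).1 hvw.symm)

lemma Reduced.of_cons {v : IntVec} {A : List IntVec} (hA : Reduced (v :: A)) : Reduced A :=
  ⟨fun w hw => hA.1 w (List.mem_cons_of_mem _ hw), (List.pairwise_cons.1 hA.2).2⟩

lemma encard_points (hφ : Function.Injective φ) {A : List IntVec} (hA : Reduced A) :
    (points φ A).encard = A.length := by
  induction A with
  | nil => simp [points]
  | cons v A ih =>
    have hv : v.eval φ ≠ 0 := fun h => hA.1 v (by simp) ((eval_eq_zero_iff hφ v).1 h)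
    obtain ⟨h, hn⟩ := points_cons hφ hA hv
    rw [h, Set.encard_insert_of_notMem hn, ih hA.of_cons, List.length_cons, Nat.cast_succ]

lemma orthogonal_iff (hφ : Function.Injective φ) {v w : IntVec} (hv : v.eval φ ≠ 0)
    (hw : w.eval φ ≠ 0) :
    (Projectivization.mk K (v.eval φ) hv).orthogonal (Projectivization.mk K (w.eval φ) hw) ↔
      dot v w = 0 := by
  rw [Projectivization.orthogonal_mk, eval_dotProduct, map_eq_zero_iff φ hφ]

/-- The multiplicity of a point with integral coordinates. -/
lemma encard_orthogonal (hφ : Function.Injective φ) {A : List IntVec} (hA : Reduced A)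
    {w : IntVec} (hw : w.eval φ ≠ 0) :
    {l ∈ points φ A | l.orthogonal (Projectivization.mk K (w.eval φ) hw)}.encard = mult A w := by
  rw [mult, ← encard_points hφ (hA.filter _)]
  congr 1
  ext p
  simp only [points, Set.mem_ofPred_eq, List.mem_filter, decide_eq_true_eq]
  constructor
  · rintro ⟨⟨v, hv, h, rfl⟩, hp⟩
    exact ⟨v, ⟨hv, (orthogonal_iff hφ h hw).1 hp⟩, h, rfl⟩
  · rintro ⟨v, ⟨hv, hvw⟩, h, rfl⟩
    exact ⟨⟨v, hv, h, rfl⟩, (orthogonal_iff hφ h hw).2 hvw⟩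

/-- The multiple points of an arrangement with integral coordinates are found by intersecting its
lines in pairs: `B` may be any list of vectors that contains the meet of each pair of lines of `A`,
unless the multiplicity of that meet is not in `N`. -/
theorem dualOp_points (hφ : Function.Injective φ) {A B : List IntVec} (hA : Reduced A)
    (hB : ∀ w ∈ B, w ≠ zero) (N : ℕ → Prop) [DecidablePred N]
    (hAB : ∀ v ∈ A, ∀ v' ∈ A, v = v' ∨ (∃ w ∈ B, dot v w = 0 ∧ dot v' w = 0) ∨
      ¬ N (mult A (cross v v')))
    {M : Set ℕ} (P : ℕ → Prop) [DecidablePred P] (hM : ∀ n, n ∈ M ↔ P n)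
    (hP : ∀ n, P n → 2 ≤ n ∧ N n) :
    dualOp M (points φ A) = points φ (B.filter fun w => P (mult A w)) := by
  ext p
  constructor
  · rintro ⟨n, hn, hp⟩
    rw [hM] at hn
    obtain ⟨hn2, hnN⟩ := hP n hn
    have h1 : 1 < {l ∈ points φ A | l.orthogonal p}.encard := by
      rw [hp]
      exact_mod_cast hn2
    obtain ⟨l, l', ⟨⟨v, hv, hv0, rfl⟩, hvp⟩, ⟨⟨v', hv', hv0', rfl⟩, hvp'⟩, hne⟩ :=
      Set.one_lt_encard_iff.1 h1
    have hc : (cross v v').eval φ ≠ 0 := by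
      rw [Ne, eval_eq_zero_iff hφ, ← mk_eval_eq_iff hφ hv0 hv0']
      exact hne
    have hc' := hc
    rw [← eval_crossProduct] at hc'
    -- two distinct lines have only one common point
    have key : ∀ w : IntVec, ∀ hw : w.eval φ ≠ 0, dot v w = 0 → dot v' w = 0 →
        p = Projectivization.mk K (w.eval φ) hw := by
      intro w hw h h'
      induction p using Projectivization.ind with | h q hq =>
      refine mk_eq_mk_of_orthogonal hc' hq hw hvp hvp' ?_ ?_
      · rw [eval_dotProduct, h, map_zero]
      · rw [eval_dotProduct, h', map_zero]
    rcases hAB v hv v' hv' with rfl | ⟨w, hw, h, h'⟩ | hN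
    · exact absurd rfl hne
    · have hw0 : w.eval φ ≠ 0 := fun h => hB w hw ((eval_eq_zero_iff hφ w).1 h)
      obtain rfl := key w hw0 h h'
      rw [encard_orthogonal hφ hA, Nat.cast_inj] at hp
      exact ⟨w, by simpa [hw, hp] using hn, hw0, rfl⟩
    · obtain rfl := key _ hc (by simp only [dot, cross]; ring) (by simp only [dot, cross]; ring)
      rw [encard_orthogonal hφ hA, Nat.cast_inj] at hp
      exact absurd (hp ▸ hnN) hN
  · rintro ⟨w, hw, hw0, rfl⟩
    simp only [List.mem_filter, decide_eq_true_eq] at hw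
    exact ⟨_, (hM _).2 hw.2, encard_orthogonal hφ hA hw0⟩

end Points

end LineArrangement

namespace LineArrangement

open IntVec

/-! ### The lines and the multiple points -/

/-- The sides of the regular octagon. -/
def octagonLines : List IntVec :=
  [⟨⟨-1, 0⟩, ⟨1, -1⟩, ⟨1, 0⟩⟩, ⟨⟨1, -1⟩, ⟨-1, 0⟩, ⟨1, 0⟩⟩, ⟨⟨-1, 1⟩, ⟨-1, 0⟩, ⟨1, 0⟩⟩,
   ⟨⟨1, 0⟩, ⟨1, -1⟩, ⟨1, 0⟩⟩, ⟨⟨1, 0⟩, ⟨-1, 1⟩, ⟨1, 0⟩⟩, ⟨⟨-1, 1⟩, ⟨1, 0⟩, ⟨1, 0⟩⟩,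
   ⟨⟨1, -1⟩, ⟨1, 0⟩, ⟨1, 0⟩⟩, ⟨⟨-1, 0⟩, ⟨-1, 1⟩, ⟨1, 0⟩⟩]

/-- The double points of the octagon arrangement: the meets of its sides, in pairs. -/
def octagonPoints : List IntVec :=
  [⟨⟨1, 0⟩, ⟨1, 0⟩, ⟨0, 1⟩⟩, ⟨⟨1, 0⟩, ⟨1, 1⟩, ⟨2, 0⟩⟩, ⟨⟨0, 0⟩, ⟨1, 1⟩, ⟨1, 0⟩⟩,
   ⟨⟨1, -1⟩, ⟨1, 0⟩, ⟨0, 0⟩⟩, ⟨⟨1, 1⟩, ⟨-1, -1⟩, ⟨0, 1⟩⟩, ⟨⟨1, 1⟩, ⟨-1, 0⟩, ⟨2, 0⟩⟩,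
   ⟨⟨1, 0⟩, ⟨0, 0⟩, ⟨1, 0⟩⟩, ⟨⟨0, 0⟩, ⟨1, 0⟩, ⟨1, 0⟩⟩, ⟨⟨-1, 0⟩, ⟨1, 1⟩, ⟨2, 0⟩⟩,
   ⟨⟨-1, -1⟩, ⟨1, 1⟩, ⟨0, 1⟩⟩, ⟨⟨-1, -1⟩, ⟨1, 0⟩, ⟨0, 0⟩⟩, ⟨⟨1, 1⟩, ⟨0, 0⟩, ⟨1, 0⟩⟩,
   ⟨⟨1, 1⟩, ⟨1, 0⟩, ⟨2, 0⟩⟩, ⟨⟨-1, 0⟩, ⟨1, 0⟩, ⟨0, 1⟩⟩, ⟨⟨-1, -1⟩, ⟨1, 0⟩, ⟨2, 0⟩⟩,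
   ⟨⟨-1, -1⟩, ⟨0, 0⟩, ⟨1, 0⟩⟩, ⟨⟨1, 1⟩, ⟨1, 0⟩, ⟨0, 0⟩⟩, ⟨⟨1, 1⟩, ⟨1, 1⟩, ⟨0, 1⟩⟩,
   ⟨⟨-1, 0⟩, ⟨0, 0⟩, ⟨1, 0⟩⟩, ⟨⟨-1, -1⟩, ⟨-1, 0⟩, ⟨2, 0⟩⟩, ⟨⟨-1, -1⟩, ⟨-1, -1⟩, ⟨0, 1⟩⟩,
   ⟨⟨-1, 1⟩, ⟨1, 0⟩, ⟨0, 0⟩⟩, ⟨⟨-1, 0⟩, ⟨-1, 0⟩, ⟨0, 1⟩⟩, ⟨⟨-1, 0⟩, ⟨-1, -1⟩, ⟨2, 0⟩⟩,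
   ⟨⟨0, 0⟩, ⟨-1, -1⟩, ⟨1, 0⟩⟩, ⟨⟨0, 0⟩, ⟨-1, 0⟩, ⟨1, 0⟩⟩, ⟨⟨1, 0⟩, ⟨-1, -1⟩, ⟨2, 0⟩⟩,
   ⟨⟨1, 0⟩, ⟨-1, 0⟩, ⟨0, 1⟩⟩]

/-- The lines that contain at least three double points of the octagon arrangement. The order is
such that the rigidity argument can determine them one after the other. -/
def lines33 : List IntVec :=
  [⟨⟨-1, -1⟩, ⟨1, 0⟩, ⟨0, 0⟩⟩, ⟨⟨1, 0⟩, ⟨0, 0⟩, ⟨0, 0⟩⟩, ⟨⟨1, 0⟩, ⟨1, -1⟩, ⟨1, 0⟩⟩,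
   ⟨⟨-1, 0⟩, ⟨1, -1⟩, ⟨1, 1⟩⟩, ⟨⟨-1, 1⟩, ⟨-1, 0⟩, ⟨1, 1⟩⟩, ⟨⟨1, 0⟩, ⟨1, -1⟩, ⟨1, 1⟩⟩,
   ⟨⟨1, 0⟩, ⟨1, 0⟩, ⟨0, 0⟩⟩, ⟨⟨-1, 1⟩, ⟨1, 0⟩, ⟨1, 1⟩⟩, ⟨⟨-1, 0⟩, ⟨1, 0⟩, ⟨0, 0⟩⟩,
   ⟨⟨-1, 0⟩, ⟨-1, 1⟩, ⟨1, 0⟩⟩, ⟨⟨-1, 1⟩, ⟨-1, 0⟩, ⟨1, 0⟩⟩, ⟨⟨-1, 0⟩, ⟨1, -1⟩, ⟨1, 0⟩⟩,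
   ⟨⟨1, -1⟩, ⟨-1, 0⟩, ⟨1, 0⟩⟩, ⟨⟨1, 0⟩, ⟨-1, -1⟩, ⟨1, 0⟩⟩, ⟨⟨-1, -1⟩, ⟨1, 0⟩, ⟨1, 0⟩⟩,
   ⟨⟨1, -1⟩, ⟨-1, 0⟩, ⟨1, 1⟩⟩, ⟨⟨-1, -1⟩, ⟨-1, 0⟩, ⟨1, 0⟩⟩, ⟨⟨1, 1⟩, ⟨1, 0⟩, ⟨0, 0⟩⟩,
   ⟨⟨1, 0⟩, ⟨-1, 1⟩, ⟨1, 0⟩⟩, ⟨⟨0, 0⟩, ⟨0, 0⟩, ⟨1, 0⟩⟩, ⟨⟨1, 1⟩, ⟨1, 0⟩, ⟨1, 0⟩⟩,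
   ⟨⟨1, 0⟩, ⟨-1, 1⟩, ⟨1, 1⟩⟩, ⟨⟨-1, 1⟩, ⟨1, 0⟩, ⟨1, 0⟩⟩, ⟨⟨-1, 0⟩, ⟨-1, 1⟩, ⟨1, 1⟩⟩,
   ⟨⟨1, -1⟩, ⟨1, 0⟩, ⟨1, 1⟩⟩, ⟨⟨-1, 1⟩, ⟨1, 0⟩, ⟨0, 0⟩⟩, ⟨⟨1, -1⟩, ⟨1, 0⟩, ⟨1, 0⟩⟩,
   ⟨⟨-1, 0⟩, ⟨-1, -1⟩, ⟨1, 0⟩⟩, ⟨⟨0, 0⟩, ⟨1, 0⟩, ⟨0, 0⟩⟩, ⟨⟨-1, 0⟩, ⟨1, 1⟩, ⟨1, 0⟩⟩,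
   ⟨⟨1, 1⟩, ⟨-1, 0⟩, ⟨1, 0⟩⟩, ⟨⟨1, 0⟩, ⟨1, 1⟩, ⟨1, 0⟩⟩, ⟨⟨1, -1⟩, ⟨1, 0⟩, ⟨0, 0⟩⟩]

/-- The multiple points of the arrangement `lines33`, by increasing multiplicity. -/
def points169 : List IntVec :=
  [⟨⟨-1, 1⟩, ⟨1, 1⟩, ⟨0, 1⟩⟩, ⟨⟨-1, 0⟩, ⟨3, 2⟩, ⟨0, 1⟩⟩, ⟨⟨0, 1⟩, ⟨-1, 0⟩, ⟨1, 0⟩⟩,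
   ⟨⟨-1, 0⟩, ⟨0, 1⟩, ⟨1, -1⟩⟩, ⟨⟨1, 1⟩, ⟨1, 0⟩, ⟨0, 2⟩⟩, ⟨⟨1, 0⟩, ⟨1, 1⟩, ⟨0, 2⟩⟩,
   ⟨⟨-1, 0⟩, ⟨0, 1⟩, ⟨1, 0⟩⟩, ⟨⟨0, 1⟩, ⟨-1, 0⟩, ⟨1, -1⟩⟩, ⟨⟨3, 2⟩, ⟨-1, 0⟩, ⟨0, 1⟩⟩,
   ⟨⟨1, 1⟩, ⟨-1, 1⟩, ⟨0, 1⟩⟩, ⟨⟨1, 1⟩, ⟨0, 1⟩, ⟨1, 0⟩⟩, ⟨⟨1, -1⟩, ⟨1, 0⟩, ⟨0, 2⟩⟩,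
   ⟨⟨1, 2⟩, ⟨1, 1⟩, ⟨2, 0⟩⟩, ⟨⟨-3, -1⟩, ⟨-1, 0⟩, ⟨2, 0⟩⟩, ⟨⟨-1, -1⟩, ⟨1, -1⟩, ⟨0, 1⟩⟩,
   ⟨⟨3, 1⟩, ⟨1, 1⟩, ⟨0, 1⟩⟩, ⟨⟨0, 1⟩, ⟨1, 0⟩, ⟨1, 0⟩⟩, ⟨⟨-1, -2⟩, ⟨-1, 0⟩, ⟨0, 1⟩⟩,
   ⟨⟨-2, -1⟩, ⟨-1, 0⟩, ⟨1, 0⟩⟩, ⟨⟨1, 0⟩, ⟨1, 0⟩, ⟨0, 0⟩⟩, ⟨⟨1, 0⟩, ⟨0, 1⟩, ⟨1, 0⟩⟩,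
   ⟨⟨1, 1⟩, ⟨3, 1⟩, ⟨0, 1⟩⟩, ⟨⟨1, 1⟩, ⟨1, 2⟩, ⟨2, 0⟩⟩, ⟨⟨1, -1⟩, ⟨-1, -1⟩, ⟨0, 1⟩⟩,
   ⟨⟨0, 1⟩, ⟨1, 1⟩, ⟨1, 0⟩⟩, ⟨⟨-1, 0⟩, ⟨-2, -1⟩, ⟨1, 0⟩⟩, ⟨⟨-1, 0⟩, ⟨-1, -2⟩, ⟨0, 1⟩⟩,
   ⟨⟨1, 0⟩, ⟨1, -1⟩, ⟨0, 2⟩⟩, ⟨⟨-1, 0⟩, ⟨-3, -1⟩, ⟨2, 0⟩⟩, ⟨⟨-1, 0⟩, ⟨1, 1⟩, ⟨0, 2⟩⟩,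
   ⟨⟨0, -1⟩, ⟨-1, 0⟩, ⟨1, -1⟩⟩, ⟨⟨-1, -1⟩, ⟨-1, 1⟩, ⟨0, 1⟩⟩, ⟨⟨-3, -2⟩, ⟨-1, 0⟩, ⟨0, 1⟩⟩,
   ⟨⟨1, 1⟩, ⟨3, 2⟩, ⟨0, 2⟩⟩, ⟨⟨-1, 0⟩, ⟨-1, -1⟩, ⟨0, 2⟩⟩, ⟨⟨-1, 1⟩, ⟨1, 0⟩, ⟨0, 2⟩⟩,
   ⟨⟨1, -1⟩, ⟨-1, 0⟩, ⟨0, 2⟩⟩, ⟨⟨-1, -1⟩, ⟨-3, -2⟩, ⟨0, 2⟩⟩, ⟨⟨0, 0⟩, ⟨1, 0⟩, ⟨0, 0⟩⟩,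
   ⟨⟨1, -1⟩, ⟨1, 1⟩, ⟨0, 1⟩⟩, ⟨⟨1, 0⟩, ⟨3, 2⟩, ⟨0, 1⟩⟩, ⟨⟨1, 0⟩, ⟨0, 1⟩, ⟨1, -1⟩⟩,
   ⟨⟨-1, -1⟩, ⟨1, 0⟩, ⟨0, 2⟩⟩, ⟨⟨0, -1⟩, ⟨-1, 0⟩, ⟨1, 0⟩⟩, ⟨⟨-1, 0⟩, ⟨3, 1⟩, ⟨2, 0⟩⟩,
   ⟨⟨-1, -1⟩, ⟨3, 2⟩, ⟨0, 2⟩⟩, ⟨⟨-1, -1⟩, ⟨1, 2⟩, ⟨2, 0⟩⟩, ⟨⟨-3, -2⟩, ⟨1, 0⟩, ⟨0, 1⟩⟩,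
   ⟨⟨-1, -1⟩, ⟨0, 1⟩, ⟨1, 0⟩⟩, ⟨⟨-1, 0⟩, ⟨0, -1⟩, ⟨1, -1⟩⟩, ⟨⟨1, 0⟩, ⟨1, 2⟩, ⟨0, 1⟩⟩,
   ⟨⟨-2, -1⟩, ⟨1, 0⟩, ⟨1, 0⟩⟩, ⟨⟨-1, 0⟩, ⟨1, 2⟩, ⟨0, 1⟩⟩, ⟨⟨1, 0⟩, ⟨0, -1⟩, ⟨1, -1⟩⟩,
   ⟨⟨-1, -1⟩, ⟨3, 1⟩, ⟨0, 1⟩⟩, ⟨⟨3, 2⟩, ⟨1, 0⟩, ⟨0, 1⟩⟩, ⟨⟨2, 1⟩, ⟨1, 0⟩, ⟨1, 0⟩⟩,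
   ⟨⟨1, 0⟩, ⟨3, 1⟩, ⟨2, 0⟩⟩, ⟨⟨1, 0⟩, ⟨0, -1⟩, ⟨1, 0⟩⟩, ⟨⟨0, 1⟩, ⟨-1, -1⟩, ⟨1, 0⟩⟩,
   ⟨⟨1, 1⟩, ⟨-1, -2⟩, ⟨2, 0⟩⟩, ⟨⟨-1, 0⟩, ⟨2, 1⟩, ⟨1, 0⟩⟩, ⟨⟨1, 1⟩, ⟨-3, -1⟩, ⟨0, 1⟩⟩,
   ⟨⟨1, 0⟩, ⟨-1, 1⟩, ⟨0, 2⟩⟩, ⟨⟨1, 1⟩, ⟨-3, -2⟩, ⟨0, 2⟩⟩, ⟨⟨1, 0⟩, ⟨-1, -1⟩, ⟨0, 2⟩⟩,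
   ⟨⟨-1, 1⟩, ⟨-1, 0⟩, ⟨0, 2⟩⟩, ⟨⟨1, 0⟩, ⟨-3, -2⟩, ⟨0, 1⟩⟩, ⟨⟨0, -1⟩, ⟨1, 0⟩, ⟨1, 0⟩⟩,
   ⟨⟨-1, -1⟩, ⟨-1, 0⟩, ⟨0, 2⟩⟩, ⟨⟨-1, 0⟩, ⟨1, 0⟩, ⟨0, 0⟩⟩, ⟨⟨1, 0⟩, ⟨0, 0⟩, ⟨0, 0⟩⟩,
   ⟨⟨0, -1⟩, ⟨1, 0⟩, ⟨1, -1⟩⟩, ⟨⟨1, 2⟩, ⟨-1, 0⟩, ⟨0, 1⟩⟩, ⟨⟨3, 1⟩, ⟨1, 0⟩, ⟨2, 0⟩⟩,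
   ⟨⟨1, 0⟩, ⟨2, 1⟩, ⟨1, 0⟩⟩, ⟨⟨3, 1⟩, ⟨-1, -1⟩, ⟨0, 1⟩⟩, ⟨⟨3, 2⟩, ⟨1, 1⟩, ⟨0, 2⟩⟩,
   ⟨⟨1, 0⟩, ⟨-2, -1⟩, ⟨1, 0⟩⟩, ⟨⟨1, 0⟩, ⟨-3, -1⟩, ⟨2, 0⟩⟩, ⟨⟨-1, 1⟩, ⟨-1, -1⟩, ⟨0, 1⟩⟩,
   ⟨⟨0, -1⟩, ⟨1, 1⟩, ⟨1, 0⟩⟩, ⟨⟨1, 0⟩, ⟨-1, -2⟩, ⟨0, 1⟩⟩, ⟨⟨-1, 0⟩, ⟨1, -1⟩, ⟨0, 2⟩⟩,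
   ⟨⟨-3, -1⟩, ⟨1, 1⟩, ⟨0, 1⟩⟩, ⟨⟨-1, 0⟩, ⟨-3, -2⟩, ⟨0, 1⟩⟩, ⟨⟨-1, -2⟩, ⟨-1, -1⟩, ⟨2, 0⟩⟩,
   ⟨⟨0, -1⟩, ⟨-1, -1⟩, ⟨1, 0⟩⟩, ⟨⟨-1, -2⟩, ⟨1, 0⟩, ⟨0, 1⟩⟩, ⟨⟨-3, -2⟩, ⟨-1, -1⟩, ⟨0, 2⟩⟩,
   ⟨⟨3, 2⟩, ⟨-1, -1⟩, ⟨0, 2⟩⟩, ⟨⟨3, 1⟩, ⟨-1, 0⟩, ⟨2, 0⟩⟩, ⟨⟨1, 2⟩, ⟨1, 0⟩, ⟨0, 1⟩⟩,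
   ⟨⟨1, 2⟩, ⟨-1, -1⟩, ⟨2, 0⟩⟩, ⟨⟨2, 1⟩, ⟨-1, 0⟩, ⟨1, 0⟩⟩, ⟨⟨-1, -1⟩, ⟨-3, -1⟩, ⟨0, 1⟩⟩,
   ⟨⟨1, 1⟩, ⟨0, -1⟩, ⟨1, 0⟩⟩, ⟨⟨1, 1⟩, ⟨-1, 0⟩, ⟨0, 2⟩⟩, ⟨⟨-1, 0⟩, ⟨-1, 1⟩, ⟨0, 2⟩⟩,
   ⟨⟨-3, -2⟩, ⟨1, 1⟩, ⟨0, 2⟩⟩, ⟨⟨1, 1⟩, ⟨1, -1⟩, ⟨0, 1⟩⟩, ⟨⟨-1, 0⟩, ⟨0, -1⟩, ⟨1, 0⟩⟩,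
   ⟨⟨0, 1⟩, ⟨1, 0⟩, ⟨1, -1⟩⟩, ⟨⟨-1, -2⟩, ⟨1, 1⟩, ⟨2, 0⟩⟩, ⟨⟨-3, -1⟩, ⟨-1, -1⟩, ⟨0, 1⟩⟩,
   ⟨⟨-1, -1⟩, ⟨0, -1⟩, ⟨1, 0⟩⟩, ⟨⟨-1, -1⟩, ⟨-1, -2⟩, ⟨2, 0⟩⟩, ⟨⟨-3, -1⟩, ⟨1, 0⟩, ⟨2, 0⟩⟩,
   ⟨⟨1, 0⟩, ⟨1, 1⟩, ⟨2, 0⟩⟩, ⟨⟨1, 1⟩, ⟨-1, 0⟩, ⟨2, 0⟩⟩, ⟨⟨-1, 0⟩, ⟨1, 1⟩, ⟨2, 0⟩⟩,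
   ⟨⟨1, 1⟩, ⟨1, 0⟩, ⟨2, 0⟩⟩, ⟨⟨-1, 1⟩, ⟨1, 0⟩, ⟨2, 0⟩⟩, ⟨⟨0, 0⟩, ⟨-1, 1⟩, ⟨1, 0⟩⟩,
   ⟨⟨-1, 0⟩, ⟨-1, 1⟩, ⟨2, 0⟩⟩, ⟨⟨1, -1⟩, ⟨-1, 1⟩, ⟨0, 1⟩⟩, ⟨⟨1, 1⟩, ⟨1, 1⟩, ⟨2, -1⟩⟩,
   ⟨⟨-1, 1⟩, ⟨-1, 1⟩, ⟨0, 1⟩⟩, ⟨⟨1, -1⟩, ⟨1, -1⟩, ⟨0, 1⟩⟩, ⟨⟨-1, -1⟩, ⟨-1, -1⟩, ⟨2, -1⟩⟩,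
   ⟨⟨-1, 1⟩, ⟨0, 0⟩, ⟨1, 0⟩⟩, ⟨⟨-1, 1⟩, ⟨-1, 0⟩, ⟨2, 0⟩⟩, ⟨⟨-1, 1⟩, ⟨1, -1⟩, ⟨0, 1⟩⟩,
   ⟨⟨1, 0⟩, ⟨-1, 1⟩, ⟨2, 0⟩⟩, ⟨⟨-1, -1⟩, ⟨1, 0⟩, ⟨2, 0⟩⟩, ⟨⟨-1, 0⟩, ⟨-1, -1⟩, ⟨2, -2⟩⟩,
   ⟨⟨-1, 0⟩, ⟨-1, -1⟩, ⟨2, 0⟩⟩, ⟨⟨1, -1⟩, ⟨-1, 0⟩, ⟨2, 0⟩⟩, ⟨⟨1, 0⟩, ⟨1, 1⟩, ⟨2, -2⟩⟩,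
   ⟨⟨0, 0⟩, ⟨-1, -1⟩, ⟨1, -1⟩⟩, ⟨⟨0, 0⟩, ⟨1, 1⟩, ⟨1, -1⟩⟩, ⟨⟨0, 0⟩, ⟨1, -1⟩, ⟨1, 0⟩⟩,
   ⟨⟨-1, -1⟩, ⟨-1, 0⟩, ⟨2, 0⟩⟩, ⟨⟨1, 1⟩, ⟨-1, 0⟩, ⟨2, -2⟩⟩, ⟨⟨1, 1⟩, ⟨0, 0⟩, ⟨1, -1⟩⟩,
   ⟨⟨1, 0⟩, ⟨-1, -1⟩, ⟨2, -2⟩⟩, ⟨⟨-1, -1⟩, ⟨1, 1⟩, ⟨2, -1⟩⟩, ⟨⟨-1, -1⟩, ⟨-1, 0⟩, ⟨2, -2⟩⟩,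
   ⟨⟨-1, -1⟩, ⟨0, 0⟩, ⟨1, -1⟩⟩, ⟨⟨1, 0⟩, ⟨1, -1⟩, ⟨2, 0⟩⟩, ⟨⟨1, 0⟩, ⟨-1, -1⟩, ⟨2, 0⟩⟩,
   ⟨⟨-1, 0⟩, ⟨1, 1⟩, ⟨2, -2⟩⟩, ⟨⟨1, -1⟩, ⟨1, 0⟩, ⟨2, 0⟩⟩, ⟨⟨1, 1⟩, ⟨-1, -1⟩, ⟨2, -1⟩⟩,
   ⟨⟨-1, -1⟩, ⟨1, 0⟩, ⟨2, -2⟩⟩, ⟨⟨1, -1⟩, ⟨0, 0⟩, ⟨1, 0⟩⟩, ⟨⟨-1, 0⟩, ⟨1, -1⟩, ⟨2, 0⟩⟩,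
   ⟨⟨1, 1⟩, ⟨1, 0⟩, ⟨2, -2⟩⟩, ⟨⟨1, 0⟩, ⟨1, 0⟩, ⟨0, 1⟩⟩, ⟨⟨0, 0⟩, ⟨1, 1⟩, ⟨1, 0⟩⟩,
   ⟨⟨1, 1⟩, ⟨-1, -1⟩, ⟨0, 1⟩⟩, ⟨⟨1, 0⟩, ⟨0, 0⟩, ⟨1, 0⟩⟩, ⟨⟨0, 0⟩, ⟨1, 0⟩, ⟨1, 0⟩⟩,
   ⟨⟨-1, -1⟩, ⟨1, 1⟩, ⟨0, 1⟩⟩, ⟨⟨1, 1⟩, ⟨0, 0⟩, ⟨1, 0⟩⟩, ⟨⟨-1, 0⟩, ⟨0, 0⟩, ⟨1, 0⟩⟩,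
   ⟨⟨1, 1⟩, ⟨1, 1⟩, ⟨0, 1⟩⟩, ⟨⟨-1, -1⟩, ⟨-1, -1⟩, ⟨0, 1⟩⟩, ⟨⟨-1, 0⟩, ⟨-1, 0⟩, ⟨0, 1⟩⟩,
   ⟨⟨0, 0⟩, ⟨-1, 0⟩, ⟨1, 0⟩⟩, ⟨⟨-1, 0⟩, ⟨1, 0⟩, ⟨0, 1⟩⟩, ⟨⟨-1, -1⟩, ⟨0, 0⟩, ⟨1, 0⟩⟩,
   ⟨⟨0, 0⟩, ⟨-1, -1⟩, ⟨1, 0⟩⟩, ⟨⟨1, 0⟩, ⟨-1, 0⟩, ⟨0, 1⟩⟩, ⟨⟨1, -1⟩, ⟨1, 0⟩, ⟨0, 0⟩⟩,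
   ⟨⟨-1, -1⟩, ⟨1, 0⟩, ⟨0, 0⟩⟩, ⟨⟨1, 1⟩, ⟨1, 0⟩, ⟨0, 0⟩⟩, ⟨⟨0, 0⟩, ⟨0, 0⟩, ⟨1, 0⟩⟩,
   ⟨⟨-1, 1⟩, ⟨1, 0⟩, ⟨0, 0⟩⟩]

lemma reduced_octagonLines : Reduced octagonLines := by decide +kernel
lemma reduced_octagonPoints : Reduced octagonPoints := by decide +kernel
lemma reduced_lines33 : Reduced lines33 := by decide +kernel
lemma reduced_points169 : Reduced points169 := by decide +kernel

/-! ### Incidences -/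

lemma octagonLines_meets : ∀ v ∈ octagonLines, ∀ v' ∈ octagonLines,
    v = v' ∨ (∃ w ∈ octagonPoints, dot v w = 0 ∧ dot v' w = 0) ∨
      ¬ 2 ≤ mult octagonLines (cross v v') := by
  decide +kernel

lemma octagonPoints_joins : ∀ v ∈ octagonPoints, ∀ v' ∈ octagonPoints,
    v = v' ∨ (∃ w ∈ lines33, dot v w = 0 ∧ dot v' w = 0) ∨
      ¬ 3 ≤ mult octagonPoints (cross v v') := by
  decide +kernel

lemma lines33_meets : ∀ v ∈ lines33, ∀ v' ∈ lines33,
    v = v' ∨ (∃ w ∈ points169, dot v w = 0 ∧ dot v' w = 0) ∨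
      ¬ 2 ≤ mult lines33 (cross v v') := by
  decide +kernel

lemma mult_octagonPoints : ∀ w ∈ octagonPoints, mult octagonLines w = 2 := by
  decide +kernel

lemma mult_lines33 : ∀ w ∈ lines33, 3 ≤ mult octagonPoints w := by
  decide +kernel

lemma map_mult_points169 : points169.map (mult lines33) =
    List.replicate 108 2 ++ List.replicate 40 3 ++ List.replicate 16 5 ++ List.replicate 5 8 := by
  decide +kernel

section

variable {K : Type*} [Field K] {φ : ℤ√2 →+* K}

/-- The point-line operator takes the octagon to the arrangement, over any field of characteristic
zero that contains `√2`. -/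
theorem pointLineOp_octagonLines (hφ : Function.Injective φ) :
    pointLineOp {2} (Set.Ici 3) (points φ octagonLines) = points φ lines33 := by
  rw [pointLineOp, dualOp_points hφ reduced_octagonLines reduced_octagonPoints.1 (2 ≤ ·)
      octagonLines_meets (· = 2) (fun _ => Set.mem_singleton_iff) (by omega),
    List.filter_eq_self.2 (by simpa using mult_octagonPoints),
    dualOp_points hφ reduced_octagonPoints reduced_lines33.1 (3 ≤ ·)
      octagonPoints_joins (3 ≤ ·) (fun _ => Set.mem_Ici) (by omega),
    List.filter_eq_self.2 (by simpa using mult_lines33)]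

theorem numPoints_lines33 (hφ : Function.Injective φ) {k : ℕ} (hk : 2 ≤ k) :
    numPoints (points φ lines33) k = ((points169.map (mult lines33)).count k : ℕ) := by
  have h : numPoints (points φ lines33) k = (dualOp {k} (points φ lines33)).encard := by
    simp [numPoints, dualOp]
  rw [h, dualOp_points hφ reduced_lines33 reduced_points169.1 (2 ≤ ·) lines33_meets (· = k)
      (fun _ => Set.mem_singleton_iff) (by omega), encard_points hφ (reduced_points169.filter _),
    List.count_eq_length_filter, List.filter_map, List.length_map]
  congr 3

end

/-! ### The octagon -/

/-- The embedding of `ℤ[√2]` in the real numbers. -/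
noncomputable def realHom : ℤ√2 →+* ℝ :=
  Zsqrtd.lift ⟨√2, by norm_num⟩

/-- The embedding of `ℤ[√2]` in the complex numbers. -/
noncomputable def complexHom : ℤ√2 →+* ℂ := Complex.ofRealHom.comp realHom

lemma two_ne_int_sq (n : ℤ) : (2 : ℤ) ≠ n * n := by
  intro h
  have h1 : n ≤ 1 := by nlinarith
  have h2 : -1 ≤ n := by nlinarith
  interval_cases n <;> omega

lemma realHom_injective : Function.Injective realHom :=
  Zsqrtd.lift_injective _ two_ne_int_sq

lemma complexHom_injective : Function.Injective complexHom :=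
  Complex.ofReal_injective.comp realHom_injective

lemma realHom_mk (a b : ℤ) : realHom ⟨a, b⟩ = a + b * √2 := by
  simp [realHom, Zsqrtd.lift]

/-- The vertices `0, …, 8` of the octagon, the last of them being the first one again, with
coordinates multiplied by `2`. -/
def octagonVertices : List IntVec :=
  [⟨⟨2, 0⟩, ⟨0, 0⟩, ⟨2, 0⟩⟩, ⟨⟨0, 1⟩, ⟨0, 1⟩, ⟨2, 0⟩⟩, ⟨⟨0, 0⟩, ⟨2, 0⟩, ⟨2, 0⟩⟩,
   ⟨⟨0, -1⟩, ⟨0, 1⟩, ⟨2, 0⟩⟩, ⟨⟨-2, 0⟩, ⟨0, 0⟩, ⟨2, 0⟩⟩, ⟨⟨0, -1⟩, ⟨0, -1⟩, ⟨2, 0⟩⟩,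
   ⟨⟨0, 0⟩, ⟨-2, 0⟩, ⟨2, 0⟩⟩, ⟨⟨0, 1⟩, ⟨0, -1⟩, ⟨2, 0⟩⟩, ⟨⟨2, 0⟩, ⟨0, 0⟩, ⟨2, 0⟩⟩]

lemma two_smul_polygonVertex {k : ℕ} (hk : k < 9) :
    (2 : ℝ) • ![Real.cos (2 * Real.pi * k / 8), Real.sin (2 * Real.pi * k / 8), 1] =
      (octagonVertices[k]'hk).eval realHom := by
  interval_cases k
  · norm_num [octagonVertices, eval, realHom_mk]
  · rw [show 2 * Real.pi * (1 : ℕ) / 8 = Real.pi / 4 by push_cast; ring]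
    norm_num [octagonVertices, eval, realHom_mk, mul_div_cancel₀]
  · rw [show 2 * Real.pi * (2 : ℕ) / 8 = Real.pi / 2 by push_cast; ring]
    norm_num [octagonVertices, eval, realHom_mk, mul_div_cancel₀]
  · rw [show 2 * Real.pi * (3 : ℕ) / 8 = Real.pi - Real.pi / 4 by push_cast; ring]
    norm_num [octagonVertices, eval, realHom_mk, mul_div_cancel₀]
  · rw [show 2 * Real.pi * (4 : ℕ) / 8 = Real.pi by push_cast; ring]
    norm_num [octagonVertices, eval, realHom_mk, mul_div_cancel₀]
  · rw [show 2 * Real.pi * (5 : ℕ) / 8 = Real.pi / 4 + Real.pi by push_cast; ring]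
    norm_num [octagonVertices, eval, realHom_mk, mul_div_cancel₀, Real.sin_add_pi,
      Real.cos_add_pi]
  · rw [show 2 * Real.pi * (6 : ℕ) / 8 = Real.pi / 2 + Real.pi by push_cast; ring]
    norm_num [octagonVertices, eval, realHom_mk, mul_div_cancel₀, Real.sin_add_pi,
      Real.cos_add_pi]
  · rw [show 2 * Real.pi * (7 : ℕ) / 8 = - (Real.pi / 4) + 2 * Real.pi by push_cast; ring]
    norm_num [octagonVertices, eval, realHom_mk, mul_div_cancel₀]
  · rw [show 2 * Real.pi * (8 : ℕ) / 8 = 2 * Real.pi by push_cast; ring]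
    norm_num [octagonVertices, eval, realHom_mk, mul_div_cancel₀]

lemma polygonVertex_eight {k : ℕ} (hk : k < 9)
    (h : (octagonVertices[k]'hk).eval realHom ≠ 0) :
    polygonVertex 8 k = Projectivization.mk ℝ _ h := by
  rw [polygonVertex, Projectivization.mk_eq_mk_iff']
  refine ⟨2⁻¹, ?_⟩
  rw [← two_smul_polygonVertex hk, smul_smul]
  norm_num

theorem polygonLines_eight : polygonLines 8 = points realHom octagonLines := by
  have hv : ∀ v : IntVec, v ≠ zero → v.eval realHom ≠ 0 :=
    fun v h h' => h ((eval_eq_zero_iff realHom_injective v).1 h')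
  have hV : ∀ v ∈ octagonVertices, v ≠ zero := by decide
  have hL : ∀ v ∈ octagonLines, v ≠ zero := reduced_octagonLines.1
  have hVL : ∀ k : Fin 8, dot (octagonLines[k]'k.2) (octagonVertices[k.1]'(by
        simp [octagonVertices]; omega)) = 0 ∧
      dot (octagonLines[k]'k.2) (octagonVertices[k.1 + 1]'(by
        simp [octagonVertices]; omega)) = 0 ∧
      cross (octagonVertices[k.1]'(by simp [octagonVertices]; omega))
        (octagonVertices[k.1 + 1]'(by simp [octagonVertices]; omega)) ≠ zero := by
    decide
  ext l
  constructor
  · rintro ⟨k, hk, h1, h2⟩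
    obtain ⟨d1, d2, hc⟩ := hVL ⟨k, hk⟩
    rw [polygonVertex_eight (by omega) (hv _ (hV _ (List.getElem_mem _)))] at h1 h2
    have hl := hv _ (hL _ (List.getElem_mem (h := hk)))
    refine ⟨octagonLines[k], List.getElem_mem _, hl, ?_⟩
    rw [Projectivization.orthogonal_comm] at h1 h2
    induction l using Projectivization.ind with | h q hq =>
    refine mk_eq_mk_of_orthogonal ?_ hl hq ?_ ?_ h1 h2
    · rw [eval_crossProduct]
      exact hv _ hc
    · rw [dotProduct_comm, eval_dotProduct]
      exact (congrArg _ d1).trans (map_zero _)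
    · rw [dotProduct_comm, eval_dotProduct]
      exact (congrArg _ d2).trans (map_zero _)
  · rintro ⟨v, hv', h, rfl⟩
    obtain ⟨k, hk, rfl⟩ := List.getElem_of_mem hv'
    have hk : k < 8 := hk
    obtain ⟨d1, d2, hc⟩ := hVL ⟨k, hk⟩
    refine ⟨k, hk, ?_, ?_⟩
    · rw [polygonVertex_eight (by omega) (hv _ (hV _ (List.getElem_mem _))),
        orthogonal_iff realHom_injective]
      exact d1
    · rw [polygonVertex_eight (by omega) (hv _ (hV _ (List.getElem_mem _))),
        orthogonal_iff realHom_injective]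
      exact d2

theorem complexify_points (A : List IntVec) :
    complexify (points realHom A) = points complexHom A := by
  have h : ∀ v : IntVec, complexVec (v.eval realHom) = v.eval complexHom := by
    intro v
    ext i
    fin_cases i <;> rfl
  ext p
  constructor
  · rintro ⟨_, ⟨v, hv, hv0, rfl⟩, rfl⟩
    refine ⟨v, hv, ?_, ?_⟩
    · rw [← h]
      exact fun h0 => hv0 (complexVec_injective (h0.trans (map_zero _).symm))
    · simp only [← h]
      rfl
  · rintro ⟨v, hv, hv0, rfl⟩
    refine ⟨_, ⟨v, hv, ?_, rfl⟩, ?_⟩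
    · rintro h0
      rw [← h, h0, map_zero] at hv0
      exact hv0 rfl
    · simp only [← h]
      rfl

end LineArrangement

namespace LineArrangement

open MvPolynomial

/-! ### Saito's criterion -/

section Saito

variable {K : Type*} [Field K]

lemma isHomogeneous_of_mul {σ : Type*} {f h : MvPolynomial σ K} {m n : ℕ}
    (hf : f.IsHomogeneous m) (h0 : f ≠ 0) (hfh : (h * f).IsHomogeneous (n + m)) :
    h.IsHomogeneous n := by
  have key : ∀ i, homogeneousComponent (i + m) (h * f) = homogeneousComponent i h * f := by
    intro i
    conv_lhs => rw [← sum_homogeneousComponent h, Finset.sum_mul, map_sum]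
    have hj : ∀ j, homogeneousComponent (i + m) (homogeneousComponent j h * f) =
        if j = i then homogeneousComponent j h * f else 0 := by
      intro j
      rw [homogeneousComponent_of_mem (n := j + m)]
      · simp only [add_left_inj, eq_comm]
      · exact (homogeneousComponent_isHomogeneous j h).mul hf
    simp only [hj, Finset.sum_ite_eq', Finset.mem_range]
    split_ifs with hi
    · rfl
    · rw [homogeneousComponent_eq_zero _ _ (by omega), zero_mul]
  have hz : ∀ i, i ≠ n → homogeneousComponent i h = 0 := by
    intro i hi
    have := key i
    rw [homogeneousComponent_of_mem hfh, if_neg (by omega)] at this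
    exact (mul_eq_zero.1 this.symm).resolve_right h0
  rw [← sum_homogeneousComponent h]
  refine IsHomogeneous.sum _ _ _ fun i _ => ?_
  by_cases hi : i = n
  · exact hi ▸ homogeneousComponent_isHomogeneous _ _
  · rw [hz i hi]
    exact isHomogeneous_zero _ _ _

/-- The determinant of the Euler derivation and of two derivations `a` and `b`. -/
noncomputable def saitoDet (a b : Fin 3 → MvPolynomial (Fin 3) K) : MvPolynomial (Fin 3) K :=
  X 0 * (a 1 * b 2 - a 2 * b 1) + X 1 * (a 2 * b 0 - a 0 * b 2) +
    X 2 * (a 0 * b 1 - a 1 * b 0)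

variable [CharZero K]

/-- Two syzygies of the Jacobian ideal of `f` that satisfy the determinant condition of Saito's
criterion are a basis of the module of syzygies. -/
theorem isFreeCurve_of_syzygies {f : MvPolynomial (Fin 3) K} {d : ℕ} {e : Fin 2 → ℕ}
    (hf : f.IsHomogeneous d) (h0 : f ≠ 0) (hsq : Squarefree f)
    (he1 : 1 ≤ e 0) (hle : e 0 ≤ e 1) (hsum : e 0 + e 1 + 1 = d)
    (hprime : ∀ g, (∀ i, f ∣ g * pderiv i f) → f ∣ g)
    (θ : Fin 2 → Fin 3 → MvPolynomial (Fin 3) K)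
    (hθ : ∀ j i, (θ j i).IsHomogeneous (e j))
    (hz : ∀ j, ∑ i, θ j i * pderiv i f = 0) {c : K} (hc : c ≠ 0)
    (hdet : saitoDet (θ 0) (θ 1) = C c * f) : IsFreeCurve f d e := by
  have hd : (d : MvPolynomial (Fin 3) K) ≠ 0 := by
    rw [Nat.cast_ne_zero]
    omega
  have hcf : C c * f ≠ 0 := mul_ne_zero (by simpa using hc) h0
  have hE : ∑ i, X i * pderiv i f = d * f := by
    rw [hf.sum_X_mul_pderiv, nsmul_eq_mul]
  have hz0 := hz 0
  have hz1 := hz 1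
  rw [Fin.sum_univ_three] at hE hz0 hz1
  refine ⟨hf, h0, hsq, he1, hle, hsum,
    Fintype.linearCombination (MvPolynomial (Fin 3) K) θ, ?_, ?_, ?_, ?_, ?_⟩
  · intro j i
    rw [Fintype.linearCombination_apply_single, one_smul]
    exact hθ j i
  · rw [injective_iff_map_eq_zero]
    intro a ha
    rw [Fintype.linearCombination_apply, Fin.sum_univ_two] at ha
    have h3 : ∀ i, a 0 * θ 0 i + a 1 * θ 1 i = 0 := fun i => by simpa using congrFun ha i
    have e0 : a 0 * (C c * f) = 0 := by
      rw [← hdet, saitoDet]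
      linear_combination (X 2 * θ 1 1 - X 1 * θ 1 2) * h3 0 +
        (X 0 * θ 1 2 - X 2 * θ 1 0) * h3 1 + (X 1 * θ 1 0 - X 0 * θ 1 1) * h3 2
    have e1 : a 1 * (C c * f) = 0 := by
      rw [← hdet, saitoDet]
      linear_combination (X 1 * θ 0 2 - X 2 * θ 0 1) * h3 0 +
        (X 2 * θ 0 0 - X 0 * θ 0 2) * h3 1 + (X 0 * θ 0 1 - X 1 * θ 0 0) * h3 2
    funext j
    fin_cases j
    · exact (mul_eq_zero.1 e0).resolve_right hcf
    · exact (mul_eq_zero.1 e1).resolve_right hcf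
  · intro η
    rw [jacobianMap, Fintype.linearCombination_apply]
    constructor
    · intro h
      rw [Fin.sum_univ_three] at h
      simp only [smul_eq_mul] at h
      -- Cramer's rule expresses `c f η` through the Euler derivation and the two syzygies; the
      -- coefficient of the Euler derivation vanishes, and `f` divides the other two
      have hα : (η 0 * (θ 0 1 * θ 1 2 - θ 0 2 * θ 1 1) + η 1 * (θ 0 2 * θ 1 0 - θ 0 0 * θ 1 2) +
          η 2 * (θ 0 0 * θ 1 1 - θ 0 1 * θ 1 0)) = 0 := by
        have : (η 0 * (θ 0 1 * θ 1 2 - θ 0 2 * θ 1 1) +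
          η 1 * (θ 0 2 * θ 1 0 - θ 0 0 * θ 1 2) +
          η 2 * (θ 0 0 * θ 1 1 - θ 0 1 * θ 1 0)) * (d * f) = 0 := by
          rw [← hE]
          linear_combination (norm := (simp only [saitoDet]; ring)) saitoDet (θ 0) (θ 1) * h -
            saitoDet η (θ 1) * hz0 - saitoDet (θ 0) η * hz1
        exact (mul_eq_zero.1 this).resolve_right (mul_ne_zero hd h0)
      have hdvd : ∀ ξ ζ : Fin 3 → MvPolynomial (Fin 3) K,
          ξ 0 * pderiv 0 f + ξ 1 * pderiv 1 f + ξ 2 * pderiv 2 f = 0 →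
          ζ 0 * pderiv 0 f + ζ 1 * pderiv 1 f + ζ 2 * pderiv 2 f = 0 → f ∣ saitoDet ξ ζ := by
        intro ξ ζ hξ hζ
        refine hprime _ fun i => ?_
        fin_cases i
        · refine ⟨d * (ξ 1 * ζ 2 - ξ 2 * ζ 1), ?_⟩
          simp only [saitoDet, Fin.zero_eta]
          linear_combination (ξ 1 * ζ 2 - ξ 2 * ζ 1) * hE + (X 2 * ζ 1 - X 1 * ζ 2) * hξ +
            (X 1 * ξ 2 - X 2 * ξ 1) * hζ
        · refine ⟨d * (ξ 2 * ζ 0 - ξ 0 * ζ 2), ?_⟩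
          simp only [saitoDet, Fin.mk_one]
          linear_combination (ξ 2 * ζ 0 - ξ 0 * ζ 2) * hE + (X 0 * ζ 2 - X 2 * ζ 0) * hξ +
            (X 2 * ξ 0 - X 0 * ξ 2) * hζ
        · refine ⟨d * (ξ 0 * ζ 1 - ξ 1 * ζ 0), ?_⟩
          simp only [saitoDet, Fin.reduceFinMk]
          linear_combination (ξ 0 * ζ 1 - ξ 1 * ζ 0) * hE + (X 1 * ζ 0 - X 0 * ζ 1) * hξ +
            (X 0 * ξ 1 - X 1 * ξ 0) * hζ
      obtain ⟨q0, hq0⟩ := hdvd η (θ 1) h hz1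
      obtain ⟨q1, hq1⟩ := hdvd (θ 0) η hz0 h
      have hcc : C c * C c⁻¹ = (1 : MvPolynomial (Fin 3) K) := by
        rw [← C_mul, mul_inv_cancel₀ hc, C_1]
      refine ⟨![C c⁻¹ * q0, C c⁻¹ * q1], ?_⟩
      rw [Fintype.linearCombination_apply, Fin.sum_univ_two]
      have hdet' := hdet
      rw [saitoDet] at hq0 hq1 hdet'
      funext i
      apply mul_left_cancel₀ hcf
      simp only [Pi.add_apply, Pi.smul_apply, smul_eq_mul, Matrix.cons_val_zero,
        Matrix.cons_val_one]
      fin_cases i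
      · simp only [Fin.zero_eta]
        linear_combination f * (q0 * θ 0 0 + q1 * θ 1 0) * hcc - θ 0 0 * hq0 - θ 1 0 * hq1 +
          η 0 * hdet' - X 0 * hα
      · simp only [Fin.mk_one]
        linear_combination f * (q0 * θ 0 1 + q1 * θ 1 1) * hcc - θ 0 1 * hq0 - θ 1 1 * hq1 +
          η 1 * hdet' - X 1 * hα
      · simp only [Fin.reduceFinMk]
        linear_combination f * (q0 * θ 0 2 + q1 * θ 1 2) * hcc - θ 0 2 * hq0 - θ 1 2 * hq1 +
          η 2 * hdet' - X 2 * hα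
    · rintro ⟨a, rfl⟩
      rw [Fintype.linearCombination_apply, Fin.sum_univ_two, Fin.sum_univ_three]
      simp only [Pi.add_apply, Pi.smul_apply, smul_eq_mul]
      linear_combination a 0 * hz0 + a 1 * hz1
  · rw [LinearMap.exact_iff, Submodule.ker_mkQ, jacobianIdeal, jacobianMap,
      Fintype.range_linearCombination]
  · exact Submodule.mkQ_surjective _

/-- Saito's criterion: two derivations that preserve the ideal of `f` and whose determinant with
the Euler derivation is `f`, up to a constant. Subtracting multiples of the Euler derivation turns
them into syzygies. -/
theorem isFreeCurve_of_saito {f : MvPolynomial (Fin 3) K} {d : ℕ} {e : Fin 2 → ℕ}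
    (hf : f.IsHomogeneous d) (h0 : f ≠ 0) (hsq : Squarefree f)
    (he1 : 1 ≤ e 0) (hle : e 0 ≤ e 1) (hsum : e 0 + e 1 + 1 = d)
    (hprime : ∀ g, (∀ i, f ∣ g * pderiv i f) → f ∣ g)
    (θ : Fin 2 → Fin 3 → MvPolynomial (Fin 3) K)
    (hθ : ∀ j i, (θ j i).IsHomogeneous (e j))
    (hdiv : ∀ j, f ∣ ∑ i, θ j i * pderiv i f) {c : K} (hc : c ≠ 0)
    (hdet : saitoDet (θ 0) (θ 1) = C c * f) : IsFreeCurve f d e := by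
  have hd : (d : K) ≠ 0 := by
    rw [Nat.cast_ne_zero]
    omega
  choose h hh using hdiv
  have hhom : ∀ j, (h j).IsHomogeneous (e j - 1) := by
    intro j
    have hej : 1 ≤ e j := by
      fin_cases j
      · exact he1
      · exact he1.trans hle
    refine isHomogeneous_of_mul hf h0 ?_
    rw [mul_comm, ← hh, show e j - 1 + d = e j + (d - 1) by omega]
    exact IsHomogeneous.sum _ _ _ fun i _ => (hθ j i).mul hf.pderiv
  refine isFreeCurve_of_syzygies hf h0 hsq he1 hle hsum hprime
    (fun j i => θ j i - C (d : K)⁻¹ * h j * X i) ?_ ?_ hc ?_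
  · intro j i
    refine (hθ j i).sub ?_
    have hej : e j = 0 + (e j - 1) + 1 := by
      have : 1 ≤ e j := by
        fin_cases j
        · exact he1
        · exact he1.trans hle
      omega
    rw [hej]
    exact ((isHomogeneous_C _ _).mul (by simpa using hhom j)).mul (isHomogeneous_X _ _)
  · intro j
    have hE : ∑ i, X i * pderiv i f = C (d : K) * f := by
      rw [hf.sum_X_mul_pderiv, nsmul_eq_mul, map_natCast]
    have hcc : C (d : K)⁻¹ * C (d : K) = (1 : MvPolynomial (Fin 3) K) := by
      rw [← C_mul, inv_mul_cancel₀ hd, C_1]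
    simp only [sub_mul, Finset.sum_sub_distrib, mul_assoc, ← Finset.mul_sum, hh, hE]
    linear_combination (-f * h j) * hcc
  · rw [← hdet, saitoDet, saitoDet]
    ring

end Saito

/-! ### Products of linear forms -/

section LinearForms

variable {K : Type*} [Field K]

/-- The linear form with coefficient vector `a`. -/
noncomputable def linearForm (a : Fin 3 → K) : MvPolynomial (Fin 3) K := ∑ i, C (a i) * X i

lemma pderiv_linearForm (a : Fin 3 → K) (i : Fin 3) : pderiv i (linearForm a) = C (a i) := by
  simp [linearForm, pderiv_X, Pi.single_apply]

lemma isHomogeneous_linearForm (a : Fin 3 → K) : (linearForm a).IsHomogeneous 1 :=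
  IsHomogeneous.sum _ _ _ fun _ _ => isHomogeneous_C_mul_X _ _

lemma linearForm_smul (c : K) (a : Fin 3 → K) : linearForm (c • a) = C c * linearForm a := by
  simp [linearForm, Finset.mul_sum, mul_assoc]

lemma linearForm_ne_zero {a : Fin 3 → K} (ha : a ≠ 0) : linearForm a ≠ 0 := by
  intro h
  apply ha
  ext i
  simpa [h] using (pderiv_linearForm a i).symm

lemma irreducible_linearForm {a : Fin 3 → K} (ha : a ≠ 0) : Irreducible (linearForm a) := by
  apply irreducible_of_totalDegree_eq_one
  · exact (isHomogeneous_linearForm a).totalDegree (linearForm_ne_zero ha)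
  · intro x hx
    rw [isUnit_iff_ne_zero]
    rintro rfl
    apply linearForm_ne_zero ha
    ext m
    simpa using hx m

lemma isRelPrime_linearForm {a b : Fin 3 → K} (ha : a ≠ 0) (hb : b ≠ 0)
    (hab : ∀ c : K, c • a ≠ b) : IsRelPrime (linearForm a) (linearForm b) := by
  rw [(irreducible_linearForm ha).isRelPrime_iff_not_dvd]
  intro h
  obtain ⟨u, hu⟩ := (irreducible_linearForm ha).associated_of_dvd (irreducible_linearForm hb) h
  obtain ⟨c, -, hc⟩ := (MvPolynomial.isUnit_iff_eq_C_of_isReduced).1 u.isUnit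
  apply hab c
  ext i
  have h1 := congrArg (pderiv i) hu
  rw [hc, mul_comm, ← linearForm_smul, pderiv_linearForm, pderiv_linearForm] at h1
  exact C_injective _ _ h1

variable {ι : Type*} {s : Finset ι} {a : ι → Fin 3 → K}

/-- If `f` is a product of distinct linear forms and divides all `g ∂ᵢ f`, then it divides `g`: a
linear factor of `f` does not divide all the partial derivatives of `f`. -/
lemma prod_linearForm_dvd (ha : ∀ i ∈ s, a i ≠ 0)
    (hs : (s : Set ι).Pairwise fun i j => IsRelPrime (linearForm (a i)) (linearForm (a j)))
    (g : MvPolynomial (Fin 3) K)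
    (hg : ∀ i, ∏ j ∈ s, linearForm (a j) ∣ g * pderiv i (∏ j ∈ s, linearForm (a j))) :
    ∏ j ∈ s, linearForm (a j) ∣ g := by
  classical
  refine Finset.prod_dvd_of_isRelPrime hs fun j hj => ?_
  have hp : Prime (linearForm (a j)) := (irreducible_linearForm (ha j hj)).prime
  obtain ⟨i, hi⟩ := Function.ne_iff.1 (ha j hj)
  have h1 := (Finset.dvd_prod_of_mem _ hj).trans (hg i)
  rw [← Finset.mul_prod_erase s _ hj, Derivation.leibniz, smul_eq_mul, smul_eq_mul,
    pderiv_linearForm, mul_add, mul_left_comm, dvd_add_right (dvd_mul_right _ _)] at h1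
  refine (hp.dvd_or_dvd h1).resolve_right fun h2 => ?_
  rcases hp.dvd_or_dvd h2 with h3 | h3
  · obtain ⟨k, hk, hk'⟩ := hp.exists_mem_finset_dvd h3
    rw [Finset.mem_erase] at hk
    exact hp.not_isUnit (hs hj hk.2 hk.1.symm dvd_rfl hk')
  · apply hp.not_isUnit
    refine isUnit_of_dvd_unit h3 ?_
    exact (isUnit_iff_ne_zero.2 hi).map C

lemma rep_smul_ne {p q : Plane K} (h : p ≠ q) (c : K) : c • p.rep ≠ q.rep := by
  intro hc
  apply h
  rw [← p.mk_rep, ← q.mk_rep, eq_comm, Projectivization.mk_eq_mk_iff']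
  exact ⟨c, hc⟩

lemma definingPoly_eq {L : Set (Plane K)} (hL : L.Finite) :
    definingPoly L = ∏ l ∈ hL.toFinset, linearForm l.rep :=
  finprod_mem_eq_finite_toFinset_prod _ hL

/-- Saito's criterion for line arrangements. -/
theorem isFree_of_saito [CharZero K] {L : Set (Plane K)} (hL : L.Finite) {d₁ d₂ : ℕ}
    (h1 : 1 ≤ d₁) (hle : d₁ ≤ d₂) (hsum : d₁ + d₂ + 1 = L.ncard)
    (θ₁ θ₂ : Fin 3 → MvPolynomial (Fin 3) K)
    (hθ₁ : ∀ i, (θ₁ i).IsHomogeneous d₁) (hθ₂ : ∀ i, (θ₂ i).IsHomogeneous d₂)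
    (hdiv₁ : definingPoly L ∣ ∑ i, θ₁ i * pderiv i (definingPoly L))
    (hdiv₂ : definingPoly L ∣ ∑ i, θ₂ i * pderiv i (definingPoly L)) {c : K} (hc : c ≠ 0)
    (hdet : saitoDet θ₁ θ₂ = C c * definingPoly L) : IsFree L d₁ d₂ := by
  have hrel : (hL.toFinset : Set (Plane K)).Pairwise fun i j =>
      IsRelPrime (linearForm i.rep) (linearForm j.rep) :=
    fun i _ j _ hij => isRelPrime_linearForm i.rep_nonzero j.rep_nonzero (rep_smul_ne hij)
  refine ⟨hL, isFreeCurve_of_saito (θ := ![θ₁, θ₂]) ?_ ?_ ?_ h1 hle hsum ?_ ?_ ?_ hc hdet⟩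
  · rw [definingPoly_eq hL, Set.ncard_eq_toFinset_card L hL, Finset.card_eq_sum_ones]
    exact IsHomogeneous.prod _ _ _ fun l _ => isHomogeneous_linearForm _
  · rw [definingPoly_eq hL, Finset.prod_ne_zero_iff]
    exact fun l _ => linearForm_ne_zero l.rep_nonzero
  · rw [definingPoly_eq hL]
    exact Finset.squarefree_prod_of_pairwise_isCoprime hrel
      fun l _ => (irreducible_linearForm l.rep_nonzero).squarefree
  · rw [definingPoly_eq hL]
    exact prod_linearForm_dvd (fun l _ => l.rep_nonzero) hrel
  · intro j
    fin_cases j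
    · exact hθ₁
    · exact hθ₂
  · intro j
    fin_cases j
    · exact hdiv₁
    · exact hdiv₂

end LinearForms

open IntVec

/-- The defining polynomial of an arrangement with integral coordinates. -/
lemma exists_definingPoly_eq {K : Type*} [Field K] {φ : ℤ√2 →+* K} (hφ : Function.Injective φ)
    {A : List IntVec} (hA : Reduced A) :
    ∃ c : K, c ≠ 0 ∧
      definingPoly (points φ A) = C c * (A.map fun v => linearForm (v.eval φ)).prod := by
  induction A with
  | nil => exact ⟨1, one_ne_zero, by simp [definingPoly, points]⟩
  | cons v A ih =>
    have hv : v.eval φ ≠ 0 := fun h => hA.1 v (by simp) ((eval_eq_zero_iff hφ v).1 h)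
    obtain ⟨c, hc, hcA⟩ := ih hA.of_cons
    obtain ⟨h, hn⟩ := points_cons hφ hA hv
    obtain ⟨u, hu⟩ := Projectivization.exists_smul_eq_mk_rep K _ hv
    have hfin : (points φ A).Finite := Set.finite_of_encard_eq_coe (encard_points hφ hA.of_cons)
    refine ⟨u * c, mul_ne_zero u.ne_zero hc, ?_⟩
    have h2 : definingPoly (points φ (v :: A)) =
        linearForm (Projectivization.mk K _ hv).rep * definingPoly (points φ A) := by
      rw [h]
      exact finprod_mem_insert _ hn hfin
    rw [h2, hcA, ← hu, List.map_cons, List.prod_cons, Units.smul_def, linearForm_smul, C_mul]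
    ring

end LineArrangement

namespace LineArrangement

open MvPolynomial IntVec

/-! ### Two derivations with octagonal symmetry -/

section Invariants

variable {S : Type*} [CommRing S]

/-- The polynomial in `R`, `t`, `Q` with the terms `c Rⁱ tʲ Qᵏ`, for `(c, i, j, k)` in the list. -/
def evalTerms (l : List (ℤ × ℕ × ℕ × ℕ)) (R t Q : S) : S :=
  (l.map fun m => (m.1 : S) * R ^ m.2.1 * t ^ m.2.2.1 * Q ^ m.2.2.2).sum

/-- The radial coefficient of the derivation of degree 15. -/
def radialTerms₁ : List (ℤ × ℕ × ℕ × ℕ) :=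
  [(12, 7, 0, 0), (-198, 6, 1, 0), (1155, 5, 2, 0), (-2898, 4, 3, 0), (3185, 3, 4, 0),
   (-1638, 2, 5, 0), (254, 1, 6, 0), (-12, 0, 7, 0), (-37, 3, 0, 1), (462, 2, 1, 1),
   (-2002, 1, 2, 1), (2868, 0, 3, 1)]

/-- The coefficient of the derivation of degree 15 along the level curves of `Re (x + i y) ^ 4`. -/
def levelTerms₁ : List (ℤ × ℕ × ℕ × ℕ) :=
  [(-4, 4, 0, 0), (66, 3, 1, 0), (-385, 2, 2, 0), (900, 1, 3, 0), (-717, 0, 4, 0), (3, 0, 0, 1)]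

/-- The radial coefficient of the derivation of degree 17. -/
def radialTerms₂ : List (ℤ × ℕ × ℕ × ℕ) :=
  [(12, 8, 0, 0), (-324, 7, 1, 0), (3216, 6, 2, 0), (-14868, 5, 3, 0), (33047, 4, 4, 0),
   (-34356, 3, 5, 0), (17054, 2, 6, 0), (-2616, 1, 7, 0), (123, 0, 8, 0), (-28, 4, 0, 1),
   (756, 3, 1, 1), (-6370, 2, 2, 1), (23016, 1, 3, 1), (-29274, 0, 4, 1), (-21, 0, 0, 2)]

/-- The coefficient of the derivation of degree 17 along the level curves of `Re (x + i y) ^ 4`. -/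
def levelTerms₂ : List (ℤ × ℕ × ℕ × ℕ) :=
  [(-4, 5, 0, 0), (108, 4, 1, 0), (-1072, 3, 2, 0), (4848, 2, 3, 0), (-9936, 1, 4, 0),
   (7344, 0, 5, 0)]

/-- The sides of an octagon have the product `Q + octagonPoly R m`, up to a constant, where
`R = 2 (x² + y²)`, `Q = 4 (Re (x + i y) ^ 4) ^ 2`, and `m` is a multiple of `z ^ 2`. -/
def octagonPoly (R m : S) : S := m * (m - R) ^ 2 * (m - 2 * R)

/-- The derivative of `octagonPoly` with respect to `R`. -/
def octagonPolyDeriv (R m : S) : S := -2 * m * (m - R) * (2 * m - 3 * R)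

/-- A derivation with radial coefficient `a` and level coefficient `b` is tangent to the octagon
with parameter `m` if and only if `Q + octagonPoly R m` divides `a - b * tangency R m`. -/
def tangency (R m : S) : S := (2 * m ^ 2 - 4 * m * R + R ^ 2) * (2 * m - 3 * R)

/-- The derivation of degree 15 is tangent to the three octagons, which have the parameters `e t`
with `e` a root of `(e - 1) (e ^ 2 - 6 e + 1)`. -/
lemma tangent₁ (e R t Q : S) (he : (e - 1) * (e ^ 2 - 6 * e + 1) = 0) :
    ∃ c, evalTerms radialTerms₁ R t Q - evalTerms levelTerms₁ R t Q * tangency R (e * t) =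
      c * (Q + octagonPoly R (e * t)) := by
  refine ⟨-37 * R ^ 3 + 462 * R ^ 2 * t - 2002 * R * t ^ 2 + 2868 * t ^ 3 -
    3 * tangency R (e * t), ?_⟩
  simp only [evalTerms, radialTerms₁, levelTerms₁, tangency, octagonPoly, List.map_cons,
    List.map_nil, List.sum_cons, List.sum_nil]
  push_cast
  linear_combination (
      12 * e ^ 4 * t ^ 7 - 90 * e ^ 3 * R * t ^ 6 + 84 * e ^ 3 * t ^ 7 + 270 * e ^ 2 * R ^ 2 *
      t ^ 5 - 630 * e ^ 2 * R * t ^ 6 + 504 * e ^ 2 * t ^ 7 - 374 * e * R ^ 3 * t ^ 4 + 1428 *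
      e * R ^ 2 * t ^ 5 - 1778 * e * R * t ^ 6 + 84 * e * t ^ 7 + 198 * R ^ 4 * t ^ 3 - 1034 *
      R ^ 3 * t ^ 4 + 1638 * R ^ 2 * t ^ 5 - 254 * R * t ^ 6 + 12 * t ^ 7) * he

/-- The derivation of degree 17 is tangent to the three octagons. -/
lemma tangent₂ (e R t Q : S) (he : (e - 1) * (e ^ 2 - 6 * e + 1) = 0) :
    ∃ c, evalTerms radialTerms₂ R t Q - evalTerms levelTerms₂ R t Q * tangency R (e * t) =
      c * (Q + octagonPoly R (e * t)) := by
  refine ⟨-21 * Q - 28 * R ^ 4 + 756 * R ^ 3 * t - 6370 * R ^ 2 * t ^ 2 + 23016 * R * t ^ 3 -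
    29274 * t ^ 4 +
    21 * octagonPoly R (e * t), ?_⟩
  simp only [evalTerms, radialTerms₂, levelTerms₂, tangency, octagonPoly, List.map_cons,
    List.map_nil, List.sum_cons, List.sum_nil]
  push_cast
  linear_combination (
      -21 * e ^ 5 * t ^ 8 + 168 * e ^ 4 * R * t ^ 7 - 147 * e ^ 4 * t ^ 8 - 546 * e ^ 3 * R ^ 2
      * t ^ 6 + 1176 * e ^ 3 * R * t ^ 7 - 882 * e ^ 3 * t ^ 8 + 924 * e ^ 2 * R ^ 3 * t ^ 5 -
      3822 * e ^ 2 * R ^ 2 * t ^ 6 + 7056 * e ^ 2 * R * t ^ 7 - 5166 * e ^ 2 * t ^ 8 - 833 * e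
      * R ^ 4 * t ^ 4 + 5712 * e * R ^ 3 * t ^ 5 - 16562 * e * R ^ 2 * t ^ 6 + 18312 * e * R *
      t ^ 7 - 861 * e * t ^ 8 + 324 * R ^ 5 * t ^ 3 - 3239 * R ^ 4 * t ^ 4 + 12324 * R ^ 3 * t
      ^ 5 - 17054 * R ^ 2 * t ^ 6 + 2616 * R * t ^ 7 - 123 * t ^ 8) * he

lemma octagonPoly_add (e R t : S) (he : e ^ 2 - 6 * e + 1 = 0) :
    octagonPoly R (e * t) + octagonPoly R ((6 - e) * t) =
      1154 * t ^ 4 - 792 * t ^ 3 * R + 170 * t ^ 2 * R ^ 2 - 12 * t * R ^ 3 := by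
  simp only [octagonPoly]
  linear_combination (2 * e ^ 2 * t ^ 4 - 12 * e * t ^ 4 + 10 * R ^ 2 * t ^ 2 - 72 * R * t ^ 3 +
    142 * t ^ 4) * he

lemma octagonPoly_mul (e R t : S) (he : e ^ 2 - 6 * e + 1 = 0) :
    octagonPoly R (e * t) * octagonPoly R ((6 - e) * t) =
      t ^ 2 * (t ^ 2 - 6 * t * R + R ^ 2) ^ 2 * (t ^ 2 - 12 * t * R + 4 * R ^ 2) := by
  have h1 : e * t * ((6 - e) * t) = t ^ 2 := by linear_combination (-t ^ 2) * he
  have h2 : (e * t - R) * ((6 - e) * t - R) = t ^ 2 - 6 * t * R + R ^ 2 := by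
    linear_combination (-t ^ 2) * he
  have h3 : (e * t - 2 * R) * ((6 - e) * t - 2 * R) = t ^ 2 - 12 * t * R + 4 * R ^ 2 := by
    linear_combination (-t ^ 2) * he
  rw [← h2, ← h3, ← h1, octagonPoly, octagonPoly]
  ring

/-- The determinant of the two derivations, in terms of the three octagons. -/
lemma det_terms (e R t Q : S) (he : e ^ 2 - 6 * e + 1 = 0) :
    evalTerms radialTerms₁ R t Q * evalTerms levelTerms₂ R t Q -
        evalTerms radialTerms₂ R t Q * evalTerms levelTerms₁ R t Q =
      63 * ((Q + octagonPoly R t) * (Q + octagonPoly R (e * t)) *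
        (Q + octagonPoly R ((6 - e) * t))) := by
  have h : (Q + octagonPoly R t) * (Q + octagonPoly R (e * t)) *
      (Q + octagonPoly R ((6 - e) * t)) = (Q + octagonPoly R t) * (Q ^ 2 +
        Q * (octagonPoly R (e * t) + octagonPoly R ((6 - e) * t)) +
        octagonPoly R (e * t) * octagonPoly R ((6 - e) * t)) := by ring
  rw [h, octagonPoly_add e R t he, octagonPoly_mul e R t he]
  simp only [evalTerms, radialTerms₁, levelTerms₁, radialTerms₂, levelTerms₂, octagonPoly,
    List.map_cons, List.map_nil, List.sum_cons, List.sum_nil]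
  push_cast
  ring

/-- The product of the sides of an octagon; here `u = √2 - 1`. -/
lemma prod_sides (u x y w : S) (hu : u ^ 2 + 2 * u - 1 = 0) :
    4 * ((w ^ 2 - (x + u * y) ^ 2) * (w ^ 2 - (u * x - y) ^ 2) *
        ((w ^ 2 - (x - u * y) ^ 2) * (w ^ 2 - (u * x + y) ^ 2))) =
      u ^ 4 * (4 * (x ^ 4 - 6 * x ^ 2 * y ^ 2 + y ^ 4) ^ 2 +
        octagonPoly (2 * (x ^ 2 + y ^ 2)) ((u + 3) * w ^ 2)) := by
  have h1 : (w ^ 2 - (x + u * y) ^ 2) * (w ^ 2 - (u * x - y) ^ 2) =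
      w ^ 4 - (2 - 2 * u) * w ^ 2 * (x ^ 2 + y ^ 2) +
        u ^ 2 * (x ^ 2 - y ^ 2 - 2 * x * y) ^ 2 := by
    have : (x + u * y) * (u * x - y) = u * (x ^ 2 - y ^ 2 - 2 * x * y) := by
      linear_combination x * y * hu
    linear_combination (-w ^ 2 * (x ^ 2 + y ^ 2)) * hu +
      ((x + u * y) * (u * x - y) + u * (x ^ 2 - y ^ 2 - 2 * x * y)) * this
  have h2 : (w ^ 2 - (x - u * y) ^ 2) * (w ^ 2 - (u * x + y) ^ 2) =
      w ^ 4 - (2 - 2 * u) * w ^ 2 * (x ^ 2 + y ^ 2) +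
        u ^ 2 * (x ^ 2 - y ^ 2 + 2 * x * y) ^ 2 := by
    have : (x - u * y) * (u * x + y) = u * (x ^ 2 - y ^ 2 + 2 * x * y) := by
      linear_combination (-x * y) * hu
    linear_combination (-w ^ 2 * (x ^ 2 + y ^ 2)) * hu +
      ((x - u * y) * (u * x + y) + u * (x ^ 2 - y ^ 2 + 2 * x * y)) * this
  rw [h1, h2]
  have h3 : ∀ r : S, 4 * ((w ^ 4 - (2 - 2 * u) * w ^ 2 * r) *
      (w ^ 4 - (2 - 2 * u) * w ^ 2 * r + 2 * u ^ 2 * r ^ 2)) =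
        u ^ 4 * octagonPoly (2 * r) ((u + 3) * w ^ 2) := by
    intro r
    simp only [octagonPoly]
    linear_combination (
      -u ^ 6 * w ^ 8 + 8 * u ^ 5 * r * w ^ 6 - 10 * u ^ 5 * w ^ 8 - 20 * u ^ 4 * r ^ 2 * w ^ 4 +
      56 * u ^ 4 * r * w ^ 6 - 35 * u ^ 4 * w ^ 8 + 16 * u ^ 3 * r ^ 3 * w ^ 2 -
      80 * u ^ 3 * r ^ 2 * w ^ 4 + 112 * u ^ 3 * r * w ^ 6 - 48 * u ^ 3 * w ^ 8 +
      16 * u ^ 2 * r ^ 3 * w ^ 2 - 40 * u ^ 2 * r ^ 2 * w ^ 4 + 48 * u ^ 2 * r * w ^ 6 -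
      20 * u ^ 2 * w ^ 8 + 16 * u * r * w ^ 6 - 8 * u * w ^ 8 - 16 * r ^ 2 * w ^ 4 +
      16 * r * w ^ 6 - 4 * w ^ 8) * hu
  linear_combination h3 (x ^ 2 + y ^ 2)

end Invariants

/-- The axes of symmetry of the octagon. -/
def mirrorLines : List IntVec :=
  [⟨⟨-1, -1⟩, ⟨1, 0⟩, ⟨0, 0⟩⟩, ⟨⟨1, 0⟩, ⟨0, 0⟩, ⟨0, 0⟩⟩, ⟨⟨1, 0⟩, ⟨1, 0⟩, ⟨0, 0⟩⟩,
   ⟨⟨-1, 0⟩, ⟨1, 0⟩, ⟨0, 0⟩⟩, ⟨⟨1, 1⟩, ⟨1, 0⟩, ⟨0, 0⟩⟩, ⟨⟨-1, 1⟩, ⟨1, 0⟩, ⟨0, 0⟩⟩,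
   ⟨⟨0, 0⟩, ⟨1, 0⟩, ⟨0, 0⟩⟩, ⟨⟨1, -1⟩, ⟨1, 0⟩, ⟨0, 0⟩⟩]

/-- The sides of the outermost of the three octagons. -/
def outerLines : List IntVec :=
  [⟨⟨-1, 0⟩, ⟨1, -1⟩, ⟨1, 1⟩⟩, ⟨⟨-1, 1⟩, ⟨-1, 0⟩, ⟨1, 1⟩⟩, ⟨⟨1, 0⟩, ⟨1, -1⟩, ⟨1, 1⟩⟩,
   ⟨⟨-1, 1⟩, ⟨1, 0⟩, ⟨1, 1⟩⟩, ⟨⟨1, -1⟩, ⟨-1, 0⟩, ⟨1, 1⟩⟩, ⟨⟨1, 0⟩, ⟨-1, 1⟩, ⟨1, 1⟩⟩,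
   ⟨⟨-1, 0⟩, ⟨-1, 1⟩, ⟨1, 1⟩⟩, ⟨⟨1, -1⟩, ⟨1, 0⟩, ⟨1, 1⟩⟩]

/-- The sides of the innermost of the three octagons. -/
def innerLines : List IntVec :=
  [⟨⟨1, 0⟩, ⟨-1, -1⟩, ⟨1, 0⟩⟩, ⟨⟨-1, -1⟩, ⟨1, 0⟩, ⟨1, 0⟩⟩, ⟨⟨-1, -1⟩, ⟨-1, 0⟩, ⟨1, 0⟩⟩,
   ⟨⟨1, 1⟩, ⟨1, 0⟩, ⟨1, 0⟩⟩, ⟨⟨-1, 0⟩, ⟨-1, -1⟩, ⟨1, 0⟩⟩, ⟨⟨-1, 0⟩, ⟨1, 1⟩, ⟨1, 0⟩⟩,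
   ⟨⟨1, 1⟩, ⟨-1, 0⟩, ⟨1, 0⟩⟩, ⟨⟨1, 0⟩, ⟨1, 1⟩, ⟨1, 0⟩⟩]

/-- The arrangement consists of the line at infinity, the axes of symmetry of the octagon, and the
sides of three concentric octagons. -/
lemma lines33_perm : lines33.Perm
    (⟨⟨0, 0⟩, ⟨0, 0⟩, ⟨1, 0⟩⟩ ::
      (mirrorLines ++ (octagonLines ++ (outerLines ++ innerLines)))) := by
  decide +kernel

/-! ### Derivations tangent to the octagons -/

section Derivations

variable {K : Type*} [Field K]

/-- The invariant `2 (x² + y²)`. -/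
noncomputable def invR : MvPolynomial (Fin 3) K := 2 * (X 0 ^ 2 + X 1 ^ 2)

/-- The real part of `(x + i y) ^ 4`. -/
noncomputable def quartA : MvPolynomial (Fin 3) K :=
  X 0 ^ 4 - 6 * X 0 ^ 2 * X 1 ^ 2 + X 1 ^ 4

/-- The imaginary part of `(x + i y) ^ 4`. -/
noncomputable def quartB : MvPolynomial (Fin 3) K :=
  4 * X 0 ^ 3 * X 1 - 4 * X 0 * X 1 ^ 3

/-- The invariant `4 (Re (x + i y) ^ 4) ^ 2`. -/
noncomputable def invQ : MvPolynomial (Fin 3) K := 4 * quartA ^ 2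

/-- The derivation `a (x ∂ₓ + y ∂ᵧ) + 2 b B (A_y ∂ₓ - A_x ∂ᵧ)`, where `A` and `B` are `quartA` and
`quartB`. -/
noncomputable def octTheta (a b : MvPolynomial (Fin 3) K) : Fin 3 → MvPolynomial (Fin 3) K :=
  ![a * X 0 + b * (2 * quartB * (4 * X 1 ^ 3 - 12 * X 0 ^ 2 * X 1)),
    a * X 1 - b * (2 * quartB * (4 * X 0 ^ 3 - 12 * X 0 * X 1 ^ 2)), 0]

/-- The derivation with the given coefficients. -/
noncomputable def toDer (θ : Fin 3 → MvPolynomial (Fin 3) K) :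
    Derivation K (MvPolynomial (Fin 3) K) (MvPolynomial (Fin 3) K) :=
  ∑ i, θ i • pderiv i

lemma toDer_apply (θ : Fin 3 → MvPolynomial (Fin 3) K) (f : MvPolynomial (Fin 3) K) :
    toDer θ f = ∑ i, θ i * pderiv i f := by
  simp [toDer, Fin.sum_univ_three]

lemma toDer_X (θ : Fin 3 → MvPolynomial (Fin 3) K) (i : Fin 3) : toDer θ (X i) = θ i := by
  simp [toDer_apply, pderiv_X, Pi.single_apply]

lemma toDer_ofNat (θ : Fin 3 → MvPolynomial (Fin 3) K) (n : ℕ) [n.AtLeastTwo] :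
    toDer θ ofNat(n) = 0 :=
  Derivation.map_natCast _ n

variable (a b : MvPolynomial (Fin 3) K)

lemma der_invR : toDer (octTheta a b) invR = 2 * a * invR + b * (8 * invQ - 2 * invR ^ 4) := by
  simp only [invR, invQ, quartA, Derivation.leibniz, Derivation.leibniz_pow, map_add, toDer_X,
    toDer_ofNat, octTheta, quartB, Matrix.cons_val, smul_eq_mul, nsmul_eq_mul]
  push_cast
  ring

lemma der_quartA : toDer (octTheta a b) quartA = 4 * a * quartA := by
  simp only [quartA, Derivation.leibniz, Derivation.leibniz_pow, map_add, map_sub, toDer_X,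
    toDer_ofNat, octTheta, quartB, Matrix.cons_val, smul_eq_mul, nsmul_eq_mul]
  push_cast
  ring

lemma der_quartB :
    toDer (octTheta a b) quartB = (4 * a - 4 * b * invR ^ 3) * quartB := by
  simp only [quartB, Derivation.leibniz, Derivation.leibniz_pow, map_sub, toDer_X, toDer_ofNat,
    octTheta, invR, Matrix.cons_val, smul_eq_mul, nsmul_eq_mul]
  push_cast
  ring

lemma der_invQ : toDer (octTheta a b) invQ = 8 * a * invQ := by
  simp only [invQ, Derivation.leibniz, Derivation.leibniz_pow, der_quartA, toDer_ofNat, smul_eq_mul,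
    nsmul_eq_mul]
  push_cast
  ring

lemma der_X_two : toDer (octTheta a b) (X 2) = 0 := by
  simp [toDer_X, octTheta]

/-- The derivation is tangent to the sides of the octagon with parameter `m` if `a` and `b` satisfy
the congruence of `tangency`. -/
lemma dvd_der_octagon {m c : MvPolynomial (Fin 3) K} (hm : toDer (octTheta a b) m = 0)
    (h : a - b * tangency invR m = c * (invQ + octagonPoly invR m)) :
    invQ + octagonPoly invR m ∣ toDer (octTheta a b) (invQ + octagonPoly invR m) := by
  have hp : toDer (octTheta a b) (octagonPoly invR m) =
      octagonPolyDeriv invR m * toDer (octTheta a b) invR := by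
    simp only [octagonPoly, octagonPolyDeriv, Derivation.leibniz, Derivation.leibniz_pow, map_sub,
      hm, toDer_ofNat, smul_eq_mul, nsmul_eq_mul]
    push_cast
    ring
  refine ⟨8 * a + 8 * b * octagonPolyDeriv invR m -
    2 * c * (m * (2 * (m - invR) * (2 * m ^ 2 - 4 * m * invR + invR ^ 2))), ?_⟩
  rw [map_add, der_invQ, hp, der_invR]
  simp only [octagonPolyDeriv, octagonPoly, tangency] at h ⊢
  linear_combination (-2 * m * (2 * (m - invR) * (2 * m ^ 2 - 4 * m * invR + invR ^ 2))) * h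

lemma saitoDet_octTheta (a' b' : MvPolynomial (Fin 3) K) :
    saitoDet (octTheta a b) (octTheta a' b') =
      -8 * (X 2 * (quartA * (quartB * (a * b' - a' * b)))) := by
  simp only [saitoDet, octTheta, quartA, Matrix.cons_val]
  ring

end Derivations

lemma dvd_derivation_mul {K S : Type*} [CommRing K] [CommRing S] [Algebra K S]
    (D : Derivation K S S) {f g : S} (hf : f ∣ D f) (hg : g ∣ D g) : f * g ∣ D (f * g) := by
  rw [Derivation.leibniz, smul_eq_mul, smul_eq_mul]
  refine dvd_add (mul_dvd_mul_left f hg) ?_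
  rw [mul_comm f]
  exact mul_dvd_mul_left g hf

section Homogeneous

variable {K : Type*} [Field K]

lemma isHomogeneous_evalTerms (l : List (ℤ × ℕ × ℕ × ℕ)) {R t Q : MvPolynomial (Fin 3) K} {n : ℕ}
    (hR : R.IsHomogeneous 2) (ht : t.IsHomogeneous 2) (hQ : Q.IsHomogeneous 8)
    (hl : ∀ m ∈ l, 2 * m.2.1 + 2 * m.2.2.1 + 8 * m.2.2.2 = n) :
    (evalTerms l R t Q).IsHomogeneous n := by
  induction l with
  | nil => exact isHomogeneous_zero _ _ _
  | cons m l ih =>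
    rw [evalTerms, List.map_cons, List.sum_cons]
    refine IsHomogeneous.add ?_ (ih fun m' hm' => hl m' (List.mem_cons_of_mem _ hm'))
    rw [← hl m (by simp), ← map_intCast (C (R := K) (σ := Fin 3))]
    have h := (((isHomogeneous_C (Fin 3) (m.1 : K)).mul (hR.pow m.2.1)).mul
      (ht.pow m.2.2.1)).mul (hQ.pow m.2.2.2)
    rwa [zero_add] at h

lemma isHomogeneous_ofNat_mul (n : ℕ) {f : MvPolynomial (Fin 3) K} {d : ℕ}
    (hf : f.IsHomogeneous d) : ((n : MvPolynomial (Fin 3) K) * f).IsHomogeneous d := by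
  rw [← map_natCast (C (R := K) (σ := Fin 3))]
  exact hf.C_mul _

lemma isHomogeneous_octTheta {a b : MvPolynomial (Fin 3) K} {n : ℕ} (ha : a.IsHomogeneous (n + 6))
    (hb : b.IsHomogeneous n) (i : Fin 3) : (octTheta a b i).IsHomogeneous (n + 7) := by
  have hx (i j k l : ℕ) (h : i + j = k) :
      ((l : MvPolynomial (Fin 3) K) * (X 0 ^ i * X 1 ^ j)).IsHomogeneous k :=
    h ▸ isHomogeneous_ofNat_mul _ ((isHomogeneous_X_pow _ _).mul (isHomogeneous_X_pow _ _))
  have hB : (2 * quartB : MvPolynomial (Fin 3) K).IsHomogeneous 4 := by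
    refine Eq.subst (motive := (IsHomogeneous · 4)) ?_ ((hx 3 1 4 8 rfl).sub (hx 1 3 4 8 rfl))
    simp only [quartB]
    push_cast
    ring
  have h1 : (4 * X 1 ^ 3 - 12 * X 0 ^ 2 * X 1 : MvPolynomial (Fin 3) K).IsHomogeneous 3 := by
    refine Eq.subst (motive := (IsHomogeneous · 3)) ?_ ((hx 0 3 3 4 rfl).sub (hx 2 1 3 12 rfl))
    push_cast
    ring
  have h2 : (4 * X 0 ^ 3 - 12 * X 0 * X 1 ^ 2 : MvPolynomial (Fin 3) K).IsHomogeneous 3 := by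
    refine Eq.subst (motive := (IsHomogeneous · 3)) ?_ ((hx 3 0 3 4 rfl).sub (hx 1 2 3 12 rfl))
    push_cast
    ring
  fin_cases i
  · exact (ha.mul (isHomogeneous_X K 0)).add (hb.mul (hB.mul h1))
  · exact (ha.mul (isHomogeneous_X K 1)).sub (hb.mul (hB.mul h2))
  · exact isHomogeneous_zero _ _ _

lemma isHomogeneous_invR : (invR : MvPolynomial (Fin 3) K).IsHomogeneous 2 :=
  isHomogeneous_ofNat_mul 2 ((isHomogeneous_X_pow 0 2).add (isHomogeneous_X_pow 1 2))

lemma isHomogeneous_invQ : (invQ : MvPolynomial (Fin 3) K).IsHomogeneous 8 := by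
  have hx (i j k l : ℕ) (h : i + j = k) :
      ((l : MvPolynomial (Fin 3) K) * (X 0 ^ i * X 1 ^ j)).IsHomogeneous k :=
    h ▸ isHomogeneous_ofNat_mul _ ((isHomogeneous_X_pow _ _).mul (isHomogeneous_X_pow _ _))
  have hA : (quartA : MvPolynomial (Fin 3) K).IsHomogeneous 4 := by
    refine Eq.subst (motive := (IsHomogeneous · 4)) ?_
      (((hx 4 0 4 1 rfl).sub (hx 2 2 4 6 rfl)).add (hx 0 4 4 1 rfl))
    simp only [quartA]
    push_cast
    ring
  exact isHomogeneous_ofNat_mul 4 (hA.pow 2)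

end Homogeneous

/-! ### Freeness of the arrangement -/

section Product

variable {K : Type*} [Field K] (φ : ℤ√2 →+* K)

/-- The constant polynomial `√2 - 1`. -/
noncomputable def unitU : MvPolynomial (Fin 3) K := C (φ ⟨-1, 1⟩)

lemma unitU_sq : unitU φ ^ 2 + 2 * unitU φ - 1 = 0 := by
  have h : (⟨-1, 1⟩ : ℤ√2) ^ 2 + 2 * ⟨-1, 1⟩ - 1 = 0 := by
    ext <;> simp [pow_two]
  have h' := congrArg (fun a => (C (φ a) : MvPolynomial (Fin 3) K)) h
  simpa [unitU, map_ofNat] using h'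

lemma C_map_mk (a b : ℤ) :
    (C (φ ⟨a, b⟩) : MvPolynomial (Fin 3) K) = a + b * (unitU φ + 1) := by
  have h : (⟨a, b⟩ : ℤ√2) = a + b * (⟨-1, 1⟩ + 1) := by ext <;> simp
  rw [h, unitU]
  simp

/-- The parameter `(2 + √2) z ^ 2`. -/
noncomputable def parT : MvPolynomial (Fin 3) K := (unitU φ + 3) * X 2 ^ 2

/-- The product of the sides of the octagon with parameter `e`, up to a constant. -/
noncomputable def octagonForm (e : MvPolynomial (Fin 3) K) : MvPolynomial (Fin 3) K :=
  invQ + octagonPoly invR (e * parT φ)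

/-- The defining polynomial of the arrangement, up to a constant. -/
noncomputable def invariantForm : MvPolynomial (Fin 3) K :=
  X 2 * (quartA * (quartB * (octagonForm φ 1 * octagonForm φ (5 + 2 * unitU φ) *
    octagonForm φ (1 - 2 * unitU φ))))

/-- The product of the linear forms with the coefficient vectors of a list. -/
noncomputable def formProd (A : List IntVec) : MvPolynomial (Fin 3) K :=
  (A.map fun v => linearForm (v.eval φ)).prod

lemma prod_mirrorLines :
    4 * formProd φ mirrorLines = -(quartA * quartB) := by
  have hu := unitU_sq φ
  simp only [formProd, mirrorLines, linearForm, IntVec.eval, Fin.sum_univ_three, Matrix.cons_val,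
    C_map_mk, List.map_cons, List.map_nil, List.prod_cons, List.prod_nil, quartA, quartB]
  set u := unitU φ
  push_cast
  have h : (X 1 ^ 2 - (u + 2) ^ 2 * X 0 ^ 2) * (X 1 ^ 2 - u ^ 2 * X 0 ^ 2) =
      (X 0 ^ 4 - 6 * X 0 ^ 2 * X 1 ^ 2 + X 1 ^ 4 : MvPolynomial (Fin 3) K) := by
    linear_combination (X 0 ^ 4 * (u ^ 2 + 2 * u + 1) - 2 * X 0 ^ 2 * X 1 ^ 2) * hu
  linear_combination 4 * X 0 * X 1 * (X 1 ^ 2 - X 0 ^ 2) * h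

lemma prod_octagonLines :
    4 * formProd φ octagonLines = unitU φ ^ 4 * octagonForm φ 1 := by
  have h := prod_sides (unitU φ) (X 0) (X 1) (X 2) (unitU_sq φ)
  simp only [formProd, octagonLines, linearForm, IntVec.eval, Fin.sum_univ_three, Matrix.cons_val,
    C_map_mk, List.map_cons, List.map_nil, List.prod_cons, List.prod_nil, octagonForm, one_mul,
    parT, invR, invQ, quartA]
  rw [← h]
  push_cast
  ring

lemma prod_outerLines :
    4 * formProd φ outerLines = unitU φ ^ 4 * octagonForm φ (5 + 2 * unitU φ) := by
  have hu := unitU_sq φ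
  have h := prod_sides (unitU φ) (X 0) (X 1) ((unitU φ + 2) * X 2) hu
  rw [show (unitU φ + 3) * ((unitU φ + 2) * X 2) ^ 2 =
      (5 + 2 * unitU φ) * ((unitU φ + 3) * X 2 ^ 2) by
    linear_combination ((unitU φ + 3) * X 2 ^ 2) * hu] at h
  simp only [formProd, outerLines, linearForm, IntVec.eval, Fin.sum_univ_three, Matrix.cons_val,
    C_map_mk, List.map_cons, List.map_nil, List.prod_cons, List.prod_nil, octagonForm,
    parT, invR, invQ, quartA]
  rw [← h]
  push_cast
  ring

lemma prod_innerLines :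
    4 * formProd φ innerLines =
      (unitU φ + 2) ^ 8 * (unitU φ ^ 4 * octagonForm φ (1 - 2 * unitU φ)) := by
  have hu := unitU_sq φ
  have h := prod_sides (unitU φ) (X 0) (X 1) (unitU φ * X 2) hu
  rw [show (unitU φ + 3) * (unitU φ * X 2) ^ 2 =
      (1 - 2 * unitU φ) * ((unitU φ + 3) * X 2 ^ 2) by
    linear_combination ((unitU φ + 3) * X 2 ^ 2) * hu] at h
  have key : ∀ a b : MvPolynomial (Fin 3) K,
      a + (unitU φ + 2) * b + X 2 = (unitU φ + 2) * (unitU φ * a + b + unitU φ * X 2) := by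
    intro a b
    linear_combination (-a - X 2) * hu
  have e1 := key (X 0) (X 1)
  have e2 := key (X 0) (-X 1)
  have e3 := key (-X 0) (X 1)
  have e4 := key (-X 0) (-X 1)
  have e5 := key (X 1) (X 0)
  have e6 := key (X 1) (-X 0)
  have e7 := key (-X 1) (X 0)
  have e8 := key (-X 1) (-X 0)
  simp only [octagonForm, parT, invR, invQ, quartA]
  rw [← h]
  have hp : formProd φ innerLines =
      (X 0 + (unitU φ + 2) * X 1 + X 2) * (X 0 + (unitU φ + 2) * -X 1 + X 2) *
      (-X 0 + (unitU φ + 2) * X 1 + X 2) * (-X 0 + (unitU φ + 2) * -X 1 + X 2) *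
      (X 1 + (unitU φ + 2) * X 0 + X 2) * (X 1 + (unitU φ + 2) * -X 0 + X 2) *
      (-X 1 + (unitU φ + 2) * X 0 + X 2) * (-X 1 + (unitU φ + 2) * -X 0 + X 2) := by
    simp only [formProd, innerLines, linearForm, IntVec.eval, Fin.sum_univ_three, Matrix.cons_val,
      C_map_mk, List.map_cons, List.map_nil, List.prod_cons, List.prod_nil]
    push_cast
    ring
  rw [hp, e1, e2, e3, e4, e5, e6, e7, e8]
  ring

lemma prod_lines33 : 256 * formProd φ lines33 =
    -(unitU φ ^ 12 * (unitU φ + 2) ^ 8) * invariantForm φ := by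
  have h : formProd φ lines33 = X 2 * (formProd φ mirrorLines * (formProd φ octagonLines *
      (formProd φ outerLines * formProd φ innerLines))) := by
    rw [formProd, (lines33_perm.map _).prod_eq]
    simp [formProd, linearForm, IntVec.eval, Fin.sum_univ_three, C_map_mk]
  rw [h]
  calc _ = X 2 * (4 * formProd φ mirrorLines * (4 * formProd φ octagonLines *
      (4 * formProd φ outerLines * (4 * formProd φ innerLines)))) := by ring
    _ = _ := by
      rw [prod_mirrorLines, prod_octagonLines, prod_outerLines, prod_innerLines, invariantForm]
      ring

end Product

section Free

variable {K : Type*} [Field K] {φ : ℤ√2 →+* K}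

lemma definingPoly_lines33 [CharZero K] (hφ : Function.Injective φ) :
    ∃ c : K, c ≠ 0 ∧ definingPoly (points φ lines33) = C c * invariantForm φ := by
  obtain ⟨c, hc, h⟩ := exists_definingPoly_eq hφ reduced_lines33
  have h1 : φ ⟨-1, 1⟩ ≠ 0 := by
    rw [Ne, map_eq_zero_iff φ hφ]
    decide
  have h2 : φ ⟨1, 1⟩ ≠ 0 := by
    rw [Ne, map_eq_zero_iff φ hφ]
    decide
  refine ⟨-c * (φ ⟨-1, 1⟩ ^ 12 * φ ⟨1, 1⟩ ^ 8) / 256, by simp [hc, h1, h2], ?_⟩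
  have h3 : (C (φ ⟨1, 1⟩) : MvPolynomial (Fin 3) K) = unitU φ + 2 := by
    rw [C_map_mk]
    push_cast
    ring
  have h4 := prod_lines33 φ
  have h5 : (C ((256 : K)⁻¹) * 256 : MvPolynomial (Fin 3) K) = 1 := by
    rw [show (256 : MvPolynomial (Fin 3) K) = C 256 from (map_ofNat C 256).symm, ← C_mul,
      inv_mul_cancel₀ (by norm_num), C_1]
  rw [h, div_eq_mul_inv]
  simp only [C_mul, C_neg, C_pow, h3]
  rw [← unitU]
  change C c * formProd φ lines33 = _
  linear_combination (-C c * formProd φ lines33) * h5 + C c * C (256 : K)⁻¹ * h4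

lemma dvd_der_invariantForm {a b : MvPolynomial (Fin 3) K}
    (h : ∀ e : MvPolynomial (Fin 3) K, (e - 1) * (e ^ 2 - 6 * e + 1) = 0 →
      ∃ c, a - b * tangency invR (e * parT φ) = c * (invQ + octagonPoly invR (e * parT φ))) :
    invariantForm φ ∣ toDer (octTheta a b) (invariantForm φ) := by
  have hu := unitU_sq φ
  have hG : ∀ e : K, ((C e : MvPolynomial (Fin 3) K) - 1) * (C e ^ 2 - 6 * C e + 1) = 0 →
      octagonForm φ (C e) ∣ toDer (octTheta a b) (octagonForm φ (C e)) := by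
    intro e he
    obtain ⟨c, hc⟩ := h _ he
    refine dvd_der_octagon a b ?_ hc
    have h3 : toDer (octTheta a b) (unitU φ) = 0 := by
      rw [unitU, ← algebraMap_eq, Derivation.map_algebraMap]
    have h4 : toDer (octTheta a b) (C e) = 0 := by
      rw [← algebraMap_eq, Derivation.map_algebraMap]
    simp [parT, Derivation.leibniz, Derivation.leibniz_pow, der_X_two, h3, h4, toDer_ofNat]
  have e1 : (1 : MvPolynomial (Fin 3) K) = C 1 := C_1.symm
  have e2 : (5 + 2 * unitU φ : MvPolynomial (Fin 3) K) = C (φ ⟨3, 2⟩) := by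
    rw [C_map_mk]
    push_cast
    ring
  have e3 : (1 - 2 * unitU φ : MvPolynomial (Fin 3) K) = C (φ ⟨3, -2⟩) := by
    rw [C_map_mk]
    push_cast
    ring
  refine dvd_derivation_mul _ ?_ (dvd_derivation_mul _ ?_ (dvd_derivation_mul _ ?_
    (dvd_derivation_mul _ (dvd_derivation_mul _ ?_ ?_) ?_)))
  · rw [der_X_two]
    exact dvd_zero _
  · rw [der_quartA]
    exact dvd_mul_left _ _
  · rw [der_quartB]
    exact dvd_mul_left _ _
  · rw [e1]
    exact hG 1 (by simp)
  · rw [e2]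
    refine hG _ ?_
    rw [← e2]
    linear_combination (4 + 2 * unitU φ) * 4 * hu
  · rw [e3]
    refine hG _ ?_
    rw [← e3]
    linear_combination (-2 * unitU φ) * 4 * hu

lemma dvd_sum_pderiv {f : MvPolynomial (Fin 3) K} {c : K} {θ : Fin 3 → MvPolynomial (Fin 3) K}
    (h : f ∣ toDer θ f) : C c * f ∣ ∑ i, θ i * pderiv i (C c * f) := by
  rw [← toDer_apply, Derivation.leibniz, ← algebraMap_eq, Derivation.map_algebraMap, smul_zero,
    add_zero, smul_eq_mul]
  exact mul_dvd_mul_left _ h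

/-- The arrangement is free over any field of characteristic zero that contains `√2`. -/
theorem isFree_lines33 [CharZero K] (hφ : Function.Injective φ) :
    IsFree (points φ lines33) 15 17 := by
  obtain ⟨c, hc, hf⟩ := definingPoly_lines33 hφ
  have hcard : (points φ lines33).encard = (33 : ℕ) := encard_points hφ reduced_lines33
  have hfin : (points φ lines33).Finite := Set.finite_of_encard_eq_coe hcard
  have hR := isHomogeneous_invR (K := K)
  have hQ := isHomogeneous_invQ (K := K)
  have hT : (parT φ).IsHomogeneous 2 := by
    have h : parT φ = C (φ ⟨2, 1⟩) * X 2 ^ 2 := by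
      rw [parT, C_map_mk]
      push_cast
      ring
    rw [h]
    exact isHomogeneous_C_mul_X_pow _ _ _
  refine isFree_of_saito (c := -504 / c) hfin (by norm_num) (by norm_num) ?_
    (octTheta (evalTerms radialTerms₁ invR (parT φ) invQ)
      (evalTerms levelTerms₁ invR (parT φ) invQ))
    (octTheta (evalTerms radialTerms₂ invR (parT φ) invQ)
      (evalTerms levelTerms₂ invR (parT φ) invQ))
    (isHomogeneous_octTheta (n := 8) (isHomogeneous_evalTerms _ hR hT hQ (by decide))
      (isHomogeneous_evalTerms _ hR hT hQ (by decide)))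
    (isHomogeneous_octTheta (n := 10) (isHomogeneous_evalTerms _ hR hT hQ (by decide))
      (isHomogeneous_evalTerms _ hR hT hQ (by decide))) ?_ ?_ (by simp [hc]) ?_
  · rw [Set.ncard, hcard]
    rfl
  · rw [hf]
    exact dvd_sum_pderiv (dvd_der_invariantForm fun e he => tangent₁ e _ _ _ he)
  · rw [hf]
    exact dvd_sum_pderiv (dvd_der_invariantForm fun e he => tangent₂ e _ _ _ he)
  · have hdet := det_terms (5 + 2 * unitU φ) invR (parT φ) invQ
      (by linear_combination 4 * unitU_sq φ)
    have hcc : (C (-504 / c) * C c : MvPolynomial (Fin 3) K) = -504 := by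
      rw [← C_mul, div_mul_cancel₀ _ hc, C_neg, map_ofNat]
    rw [saitoDet_octTheta, hdet, hf, ← mul_assoc (C _), hcc, invariantForm, octagonForm,
      octagonForm, octagonForm, one_mul, show (6 - (5 + 2 * unitU φ)) = 1 - 2 * unitU φ by ring]
    ring

end Free

end LineArrangement

namespace LineArrangement

open IntVec

/-! ### Incidences determine the arrangement up to conjugation -/

section Frames

variable {K : Type*} [Field K]

/-- The determinant of three vectors. -/
def bracket (u v w : Fin 3 → K) : K :=
  u 0 * (v 1 * w 2 - v 2 * w 1) + u 1 * (v 2 * w 0 - v 0 * w 2) +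
    u 2 * (v 0 * w 1 - v 1 * w 0)

lemma det_eq_bracket (u v w : Fin 3 → K) : (Matrix.of ![u, v, w]).det = bracket u v w := by
  rw [Matrix.det_fin_three, bracket]
  simp only [Matrix.of_apply, Matrix.cons_val]
  ring

lemma bracket_eq_dotProduct (u v w : Fin 3 → K) : bracket u v w = u ⬝ᵥ crossProduct v w := by
  simp [bracket, cross_apply, dotProduct, Fin.sum_univ_three]

lemma bracket_smul (a b c : K) (u v w : Fin 3 → K) :
    bracket (a • u) (b • v) (c • w) = a * b * c * bracket u v w := by
  simp only [bracket, Pi.smul_apply, smul_eq_mul]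
  ring

lemma bracket_mulVec (g : Matrix (Fin 3) (Fin 3) K) (u v w : Fin 3 → K) :
    bracket (g.mulVec u) (g.mulVec v) (g.mulVec w) = g.det * bracket u v w := by
  simp only [bracket, Matrix.det_fin_three, Matrix.mulVec, dotProduct, Fin.sum_univ_three]
  ring

lemma GL_det_ne_zero (g : GL (Fin 3) K) : g.1.det ≠ 0 :=
  (Matrix.isUnit_iff_isUnit_det _).1 g.isUnit |>.ne_zero

/-- Four lines of which no three are concurrent are a projective frame. -/
lemma exists_frame {a b c d : Fin 3 → K} (h₁ : bracket d b c ≠ 0) (h₂ : bracket a d c ≠ 0)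
    (h₃ : bracket a b d ≠ 0) (h₀ : bracket a b c ≠ 0) :
    ∃ g : GL (Fin 3) K, (∃ t, t ≠ 0 ∧ g.1.mulVec a = ![t, 0, 0]) ∧
      (∃ t, t ≠ 0 ∧ g.1.mulVec b = ![0, t, 0]) ∧ (∃ t, t ≠ 0 ∧ g.1.mulVec c = ![0, 0, t]) ∧
      (∃ t, t ≠ 0 ∧ g.1.mulVec d = ![t, t, t]) := by
  -- Cramer's rule: the rows of the matrix are scaled so that `d` has equal coordinates
  let M : Matrix (Fin 3) (Fin 3) K := Matrix.of
    ![(bracket d b c)⁻¹ • crossProduct b c, (bracket a d c)⁻¹ • crossProduct c a,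
      (bracket a b d)⁻¹ • crossProduct a b]
  have hM : ∀ v, M.mulVec v = ![(bracket d b c)⁻¹ * bracket v b c,
      (bracket a d c)⁻¹ * bracket a v c, (bracket a b d)⁻¹ * bracket a b v] := by
    intro v
    ext i
    fin_cases i <;>
    · simp [M, Matrix.mulVec, bracket, cross_apply, dotProduct, Fin.sum_univ_three]
      ring
  have z1 : bracket a b a = 0 := by simp only [bracket]; ring
  have z2 : bracket a a c = 0 := by simp only [bracket]; ring
  have z3 : bracket b b c = 0 := by simp only [bracket]; ring
  have z4 : bracket a b b = 0 := by simp only [bracket]; ring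
  have z5 : bracket c b c = 0 := by simp only [bracket]; ring
  have z6 : bracket a c c = 0 := by simp only [bracket]; ring
  have ha := hM a
  have hb := hM b
  have hc := hM c
  have hd := hM d
  simp only [z1, z2, z3, z4, z5, z6, mul_zero, inv_mul_cancel₀ h₁, inv_mul_cancel₀ h₂,
    inv_mul_cancel₀ h₃] at ha hb hc hd
  have hdet : M.det ≠ 0 := by
    intro h
    have h' := bracket_mulVec M a b c
    rw [h, ha, hb, hc, zero_mul] at h'
    simp [bracket] at h'
    simp [bracket] at h₀ h₁ h₂ h₃
    tauto
  refine ⟨Matrix.GeneralLinearGroup.mkOfDetNeZero M hdet, ⟨_, ?_, ha⟩, ⟨_, ?_, hb⟩, ⟨_, ?_, hc⟩,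
    ⟨1, one_ne_zero, hd⟩⟩
  · exact mul_ne_zero (inv_ne_zero h₁) h₀
  · exact mul_ne_zero (inv_ne_zero h₂) h₀
  · exact mul_ne_zero (inv_ne_zero h₃) h₀

end Frames

/-- The lines of the arrangement. -/
def line33 (i : Fin 33) : IntVec := lines33[i]'i.2

section Chain

variable {K : Type*} [Field K]

/-- Vectors with the same incidences as the lines of the arrangement. -/
def SameIncidences (c : Fin 33 → Fin 3 → K) : Prop :=
  ∀ i j k, bracket (c i) (c j) (c k) = 0 ↔ dot (line33 i) (cross (line33 j) (line33 k)) = 0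

/-- The line `i` joins the meet of the lines `a`, `b` with the meet of the lines `c`, `d`, for
`(a, b, c, d)` the `i`-th entry; the entries of the four frame lines and of the line `7` are
irrelevant. -/
def joins33 : List (Fin 33 × Fin 33 × Fin 33 × Fin 33) :=
  [(0, 0, 0, 0), (0, 0, 0, 0), (0, 0, 0, 0), (0, 0, 0, 0), (1, 2, 0, 3), (0, 2, 3, 1),
   (5, 4, 0, 1), (0, 0, 0, 0), (0, 1, 2, 7), (8, 3, 0, 2), (3, 8, 2, 6), (0, 10, 1, 2),
   (8, 11, 1, 10), (8, 11, 4, 10), (8, 11, 0, 2), (1, 2, 7, 12), (3, 11, 1, 10), (3, 11, 2, 12),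
   (3, 11, 4, 5), (3, 11, 7, 12), (3, 11, 1, 14), (3, 11, 2, 7), (6, 11, 7, 12), (6, 11, 3, 12),
   (6, 11, 4, 10), (7, 12, 13, 20), (11, 25, 3, 12), (9, 11, 7, 12), (9, 11, 3, 12),
   (9, 11, 4, 10), (1, 10, 6, 13), (7, 12, 2, 13), (9, 12, 4, 10)]

lemma joins33_spec : ∀ i : Fin 33, i ∈ [0, 1, 2, 3, 7] ∨
    ∃ m ∈ joins33[i.1]?, m.1 < i ∧ m.2.1 < i ∧ m.2.2.1 < i ∧ m.2.2.2 < i ∧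
      dot (line33 i) (cross (line33 m.1) (line33 m.2.1)) = 0 ∧
      dot (line33 i) (cross (line33 m.2.2.1) (line33 m.2.2.2)) = 0 ∧
      cross (cross (line33 m.1) (line33 m.2.1)) (cross (line33 m.2.2.1) (line33 m.2.2.2)) ≠
        zero := by
  decide +kernel

lemma line33_ne_zero (i : Fin 33) : line33 i ≠ zero := reduced_lines33.1 _ (List.getElem_mem _)

lemma bracket_eval (ψ : ℤ√2 →+* K) (u v w : IntVec) :
    bracket (u.eval ψ) (v.eval ψ) (w.eval ψ) = ψ (dot u (cross v w)) := by
  rw [← det_eq_bracket, det_eval]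

lemma sameIncidences_eval {ψ : ℤ√2 →+* K} (hψ : Function.Injective ψ) :
    SameIncidences fun i => (line33 i).eval ψ := fun i j k => by
  simp only [bracket_eval, map_eq_zero_iff ψ hψ]

lemma SameIncidences.mulVec {c : Fin 33 → Fin 3 → K} (hc : SameIncidences c) (g : GL (Fin 3) K) :
    SameIncidences fun i => g.1.mulVec (c i) := fun i j k => by
  simp only [bracket_mulVec, mul_eq_zero, GL_det_ne_zero g, false_or]
  exact hc i j k

lemma exists_bracket_ne_zero : ∀ i : Fin 33, ∃ j ∈ ([0, 1, 2, 3] : List (Fin 33)),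
    ∃ k ∈ ([0, 1, 2, 3] : List (Fin 33)), dot (line33 i) (cross (line33 j) (line33 k)) ≠ 0 := by
  decide +kernel

lemma SameIncidences.ne_zero {c : Fin 33 → Fin 3 → K} (hc : SameIncidences c) (i : Fin 33) :
    c i ≠ 0 := by
  intro h
  obtain ⟨j, -, k, -, hijk⟩ := exists_bracket_ne_zero i
  apply hijk
  rw [← hc, h]
  simp [bracket]

/-- A family with the same incidences that contains the lines `0`, `1`, `2`, `3` and `7` is the
arrangement: every other line joins two points that are known already. -/
lemma SameIncidences.eq_smul_eval {c : Fin 33 → Fin 3 → K} (hc : SameIncidences c)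
    {ψ : ℤ√2 →+* K} (hψ : Function.Injective ψ)
    (h : ∀ i ∈ ([0, 1, 2, 3, 7] : List (Fin 33)), ∃ t : Kˣ, c i = (t : K) • (line33 i).eval ψ)
    (i : Fin 33) : ∃ t : Kˣ, c i = (t : K) • (line33 i).eval ψ := by
  induction i using WellFoundedLT.induction with | _ i ih =>
  rcases joins33_spec i with hi | ⟨⟨m₁, m₂, m₃, m₄⟩, -, l₁, l₂, l₃, l₄, h₁, h₂, hne⟩
  · exact h i hi
  obtain ⟨t₁, e₁⟩ := ih m₁ l₁
  obtain ⟨t₂, e₂⟩ := ih m₂ l₂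
  obtain ⟨t₃, e₃⟩ := ih m₃ l₃
  obtain ⟨t₄, e₄⟩ := ih m₄ l₄
  have hc₁ := (hc i m₁ m₂).2 h₁
  have hc₂ := (hc i m₃ m₄).2 h₂
  rw [e₁, e₂, ← one_smul K (c i), bracket_smul] at hc₁
  rw [e₃, e₄, ← one_smul K (c i), bracket_smul] at hc₂
  replace hc₁ := (mul_eq_zero.1 hc₁).resolve_left (by simp)
  replace hc₂ := (mul_eq_zero.1 hc₂).resolve_left (by simp)
  rw [bracket_eq_dotProduct, eval_crossProduct, dotProduct_comm] at hc₁ hc₂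
  have hl : (line33 i).eval ψ ≠ 0 := by
    rw [Ne, eval_eq_zero_iff hψ]
    exact line33_ne_zero i
  have hmk := mk_eq_mk_of_orthogonal (a := eval ψ (cross (line33 m₁) (line33 m₂)))
    (b := eval ψ (cross (line33 m₃) (line33 m₄))) (by
      rw [eval_crossProduct, Ne, eval_eq_zero_iff hψ]
      exact hne) (hc.ne_zero i) hl hc₁ hc₂
    (by rw [dotProduct_comm, eval_dotProduct, h₁, map_zero])
    (by rw [dotProduct_comm, eval_dotProduct, h₂, map_zero])
  obtain ⟨t, ht⟩ := (Projectivization.mk_eq_mk_iff K _ _ _ _).1 hmk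
  exact ⟨t, ht.symm⟩

/-- A multihomogeneous expression in the frame and the line `7`. For a family with the same
incidences it vanishes if and only if `τ - 1` is the cross ratio of the points in which the lines
`0`, `1`, `3`, `7` meet the line `2`. -/
def crossRatioEq (τ : K) (c : Fin 33 → Fin 3 → K) : K :=
  bracket (c 7) (c 1) (c 2) * bracket (c 3) (c 0) (c 2) -
    (τ - 1) * (bracket (c 7) (c 0) (c 2) * bracket (c 3) (c 1) (c 2))

/-- In the coordinates given by the frame, the line `7` is `(X, Y, (X + Y) / 2)` with
`(X + Y) ^ 2 = 2 Y ^ 2`; this follows from the incidences of the first ten lines. -/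
lemma SameIncidences.exists_normal_form [CharZero K] {c : Fin 33 → Fin 3 → K}
    (hc : SameIncidences c) :
    ∃ g : GL (Fin 3) K, (∃ t, t ≠ 0 ∧ g.1.mulVec (c 0) = ![t, 0, 0]) ∧
      (∃ t, t ≠ 0 ∧ g.1.mulVec (c 1) = ![0, t, 0]) ∧
      (∃ t, t ≠ 0 ∧ g.1.mulVec (c 2) = ![0, 0, t]) ∧
      (∃ t, t ≠ 0 ∧ g.1.mulVec (c 3) = ![t, t, t]) ∧
      ∃ x y, y ≠ 0 ∧ g.1.mulVec (c 7) = ![x, y, (x + y) / 2] ∧ (x + y) ^ 2 = 2 * y ^ 2 ∧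
        ∀ τ, crossRatioEq τ c = 0 ↔ x + y = τ * y := by
  obtain ⟨g, ⟨t₀, ht₀, e₀⟩, ⟨t₁, ht₁, e₁⟩, ⟨t₂, ht₂, e₂⟩, ⟨t₃, ht₃, e₃⟩⟩ :=
    exists_frame (a := c 0) (b := c 1) (c := c 2) (d := c 3)
      (by rw [Ne, hc]; decide +kernel) (by rw [Ne, hc]; decide +kernel)
      (by rw [Ne, hc]; decide +kernel) (by rw [Ne, hc]; decide +kernel)
  refine ⟨g, ⟨t₀, ht₀, e₀⟩, ⟨t₁, ht₁, e₁⟩, ⟨t₂, ht₂, e₂⟩, ⟨t₃, ht₃, e₃⟩, ?_⟩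
  have hg := hc.mulVec g
  have hg0 := hg.ne_zero
  have hdet := GL_det_ne_zero g
  have hcr : ∀ τ, g.1.det ^ 2 * crossRatioEq τ c = crossRatioEq τ fun i => g.1.mulVec (c i) := by
    intro τ
    simp only [crossRatioEq, bracket_mulVec]
    ring
  set y : Fin 33 → Fin 3 → K := fun i => g.1.mulVec (c i) with hy
  change y 0 = _ at e₀
  change y 1 = _ at e₁
  change y 2 = _ at e₂
  change y 3 = _ at e₃
  change ∃ x y', y' ≠ 0 ∧ y 7 = _ ∧ _
  have nz : ∀ i, ¬ (y i 0 = 0 ∧ y i 1 = 0 ∧ y i 2 = 0) := by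
    rintro i ⟨h0, h1, h2⟩
    apply hg0 i
    ext j
    fin_cases j
    · exact h0
    · exact h1
    · exact h2
  -- the incidences of the first ten lines, in coordinates
  have b1 := (hg 4 1 2).2 (by decide +kernel)
  have b2 := (hg 4 0 3).2 (by decide +kernel)
  have b3 := (hg 5 0 2).2 (by decide +kernel)
  have b4 := (hg 5 3 1).2 (by decide +kernel)
  have b5 := (hg 6 5 4).2 (by decide +kernel)
  have b6 := (hg 6 0 1).2 (by decide +kernel)
  have b7 := (hg 7 6 3).2 (by decide +kernel)
  have b8 := (hg 8 0 1).2 (by decide +kernel)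
  have b9 := (hg 8 2 7).2 (by decide +kernel)
  have b10 := (hg 9 8 3).2 (by decide +kernel)
  have b11 := (hg 9 0 2).2 (by decide +kernel)
  have b12 := (hg 9 1 7).2 (by decide +kernel)
  have b13 := (hg 7 0 2).not.2 (by decide +kernel)
  simp only [bracket, e₀, e₁, e₂, e₃, Matrix.cons_val, mul_zero, zero_mul, sub_zero, zero_sub,
    add_zero, zero_add, mul_neg, neg_eq_zero, mul_eq_zero, ht₀, ht₁, ht₂, or_false, ← mul_assoc
    ] at b1 b2 b3 b4 b5 b6 b7 b8 b9 b10 b11 b12 b13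
  have f2 : y 4 2 = y 4 1 :=
    mul_left_cancel₀ (mul_ne_zero ht₀ ht₃) (by linear_combination b2)
  have f4 : y 5 2 = y 5 0 :=
    mul_left_cancel₀ (mul_ne_zero ht₁ ht₃) (by linear_combination b4)
  have n4 : y 4 1 ≠ 0 := fun h => nz 4 ⟨b1, h, f2.trans h⟩
  have n5 : y 5 0 ≠ 0 := fun h => nz 5 ⟨h, b3, f4.trans h⟩
  rw [b1, b3, b6, f2, f4] at b5
  have f6 : y 6 1 = -y 6 0 :=
    mul_left_cancel₀ (mul_ne_zero n4 n5) (by linear_combination -b5)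
  have n6 : y 6 0 ≠ 0 := fun h => nz 6 ⟨h, by rw [f6, h, neg_zero], b6⟩
  rw [b6, f6] at b7
  have f7 : 2 * y 7 2 = y 7 0 + y 7 1 :=
    mul_left_cancel₀ (mul_ne_zero n6 ht₃) (by linear_combination b7)
  have f9 : y 8 1 * y 7 0 = y 8 0 * y 7 1 := mul_left_cancel₀ ht₂ (by linear_combination b9)
  have n8 : y 8 1 ≠ 0 := fun h => nz 8
    ⟨(mul_eq_zero.1 (by rw [← f9, h, zero_mul])).resolve_right b13, h, b8⟩
  rw [b8, b11] at b10
  have f12 : y 9 0 * y 7 2 = y 9 2 * y 7 0 := mul_left_cancel₀ ht₁ (by linear_combination b12)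
  have f10 : y 9 0 * y 7 1 + y 9 2 * (y 7 0 - y 7 1) = 0 :=
    mul_left_cancel₀ (mul_ne_zero n8 ht₃) (by
      linear_combination (y 7 1) * b10 + (y 9 2 * t₃) * f9)
  have n9 : y 9 2 ≠ 0 := fun h => nz 9
    ⟨(mul_eq_zero.1 (by simpa [h] using f10)).resolve_right b13, b11, h⟩
  have f13 : y 7 0 * y 7 1 + (y 7 0 - y 7 1) * y 7 2 = 0 :=
    mul_left_cancel₀ n9 (by linear_combination (y 7 2) * f10 - (y 7 1) * f12)
  refine ⟨y 7 0, y 7 1, b13, ?_, ?_, fun τ => ?_⟩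
  · ext j
    fin_cases j
    · rfl
    · rfl
    · change y 7 2 = (y 7 0 + y 7 1) / 2
      rw [← f7]
      ring
  · linear_combination 2 * f13 - (y 7 0 - y 7 1) * f7
  · have hτ := hcr τ
    rw [show crossRatioEq τ y = bracket (y 7) (y 1) (y 2) * bracket (y 3) (y 0) (y 2) -
      (τ - 1) * (bracket (y 7) (y 0) (y 2) * bracket (y 3) (y 1) (y 2)) from rfl,
      e₀, e₁, e₂, e₃] at hτ
    simp only [bracket, Matrix.cons_val] at hτ
    have hne : t₀ * t₁ * t₂ ^ 2 * t₃ ≠ 0 := by simp [ht₀, ht₁, ht₂, ht₃]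
    constructor
    · intro h
      rw [h] at hτ
      exact mul_left_cancel₀ hne (by linear_combination hτ)
    · intro h
      refine (mul_eq_zero.1 ?_).resolve_left (pow_ne_zero 2 hdet)
      linear_combination hτ - (t₀ * t₁ * t₂ ^ 2 * t₃) * h

/-- A family with the same incidences as the arrangement is projectively equivalent to the
arrangement over `ψ`, if the two have the same cross ratio. -/
theorem SameIncidences.exists_eq_smul [CharZero K] {c : Fin 33 → Fin 3 → K}
    (hc : SameIncidences c) {ψ : ℤ√2 →+* K} (hψ : Function.Injective ψ) {τ : K}
    (hτ : crossRatioEq τ c = 0) (hτ' : crossRatioEq τ (fun i => (line33 i).eval ψ) = 0) :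
    ∃ g : GL (Fin 3) K, ∀ i, ∃ t : Kˣ, c i = (t : K) • g.1.mulVec ((line33 i).eval ψ) := by
  obtain ⟨g, ⟨t₀, ht₀, e₀⟩, ⟨t₁, ht₁, e₁⟩, ⟨t₂, ht₂, e₂⟩, ⟨t₃, ht₃, e₃⟩, x, y, hy, e₇, -, hr⟩ :=
    hc.exists_normal_form
  obtain ⟨h, ⟨s₀, hs₀, d₀⟩, ⟨s₁, hs₁, d₁⟩, ⟨s₂, hs₂, d₂⟩, ⟨s₃, hs₃, d₃⟩, x', y', hy', d₇, -, hr'⟩ :=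
    (sameIncidences_eval hψ).exists_normal_form
  rw [hr] at hτ
  rw [hr'] at hτ'
  -- the frames agree after a projective transformation, and then so do the lines `7`
  have hinv : ∀ v, (h⁻¹ * g).1.mulVec v = (h⁻¹).1.mulVec (g.1.mulVec v) := fun v => by
    rw [Units.val_mul, Matrix.mulVec_mulVec]
  have hinv' : ∀ v, (h⁻¹).1.mulVec (h.1.mulVec v) = v := fun v => by
    rw [Matrix.mulVec_mulVec, ← Units.val_mul, inv_mul_cancel, Units.val_one, Matrix.one_mulVec]
  have step : ∀ i (a b : K), a ≠ 0 → b ≠ 0 →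
      b • g.1.mulVec (c i) = a • h.1.mulVec ((line33 i).eval ψ) →
      ∃ t : Kˣ, (h⁻¹ * g).1.mulVec (c i) = (t : K) • (line33 i).eval ψ := by
    intro i a b ha hb hab
    refine ⟨Units.mk0 (b⁻¹ * a) (mul_ne_zero (inv_ne_zero hb) ha), ?_⟩
    have e : g.1.mulVec (c i) = (b⁻¹ * a) • h.1.mulVec ((line33 i).eval ψ) := by
      rw [← smul_smul, ← hab, smul_smul, inv_mul_cancel₀ hb, one_smul]
    rw [hinv, e, Matrix.mulVec_smul, hinv']
    rfl
  have hchain := (hc.mulVec (h⁻¹ * g)).eq_smul_eval hψ (by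
    intro i hi
    simp only [List.mem_cons, List.not_mem_nil, or_false] at hi
    rcases hi with rfl | rfl | rfl | rfl | rfl
    · exact step 0 t₀ s₀ ht₀ hs₀ (by rw [e₀, d₀]; simp [mul_comm])
    · exact step 1 t₁ s₁ ht₁ hs₁ (by rw [e₁, d₁]; simp [mul_comm])
    · exact step 2 t₂ s₂ ht₂ hs₂ (by rw [e₂, d₂]; simp [mul_comm])
    · exact step 3 t₃ s₃ ht₃ hs₃ (by rw [e₃, d₃]; simp [mul_comm])
    · refine step 7 y y' hy hy' ?_
      rw [e₇, d₇, hτ, hτ', show x = τ * y - y by rw [← hτ]; ring,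
        show x' = τ * y' - y' by rw [← hτ']; ring]
      ext j
      fin_cases j <;> simp <;> ring)
  refine ⟨g⁻¹ * h, fun i => ?_⟩
  obtain ⟨t, ht⟩ := hchain i
  refine ⟨t, ?_⟩
  rw [← Matrix.mulVec_smul, ← ht, Matrix.mulVec_mulVec, ← Units.val_mul]
  simp [mul_assoc]

end Chain

/-! ### The moduli space -/

section Rigid

variable {K : Type*} [Field K] {φ : ℤ√2 →+* K}

/-- The lines of the arrangement, in the plane over `K`. -/
noncomputable def lineAt (hφ : Function.Injective φ) (i : Fin 33) : points φ lines33 :=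
  ⟨Projectivization.mk K ((line33 i).eval φ)
      fun h => line33_ne_zero i ((eval_eq_zero_iff hφ _).1 h),
    line33 i, List.getElem_mem _, _, rfl⟩

lemma lineAt_surjective (hφ : Function.Injective φ) : Function.Surjective (lineAt hφ) := by
  rintro ⟨_, v, hv, h, rfl⟩
  obtain ⟨i, hi, rfl⟩ := List.getElem_of_mem hv
  exact ⟨⟨i, hi⟩, rfl⟩

/-- The columns of a realization, in the order of the list of lines. -/
noncomputable def colAt (hφ : Function.Injective φ) (R : Realization (points φ lines33))
    (i : Fin 33) : Fin 3 → K := R.col (lineAt hφ i)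

lemma sameIncidences_colAt (hφ : Function.Injective φ) (R : Realization (points φ lines33)) :
    SameIncidences (colAt hφ R) := by
  intro i j k
  have hrep : ∀ i, ∃ a : Kˣ, (lineAt hφ i).1.rep = (a : K) • (line33 i).eval φ := by
    intro i
    obtain ⟨a, ha⟩ := Projectivization.exists_smul_eq_mk_rep K ((line33 i).eval φ)
      fun h => line33_ne_zero i ((eval_eq_zero_iff hφ _).1 h)
    exact ⟨a, ha.symm⟩
  obtain ⟨a, ha⟩ := hrep i
  obtain ⟨b, hb⟩ := hrep j
  obtain ⟨c, hc⟩ := hrep k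
  have h := R.det_ne_zero_iff (lineAt hφ i) (lineAt hφ j) (lineAt hφ k)
  rw [not_iff_not, det_eq_bracket, det_eq_bracket, ha, hb, hc, bracket_smul, bracket_eval] at h
  simpa [map_eq_zero_iff φ hφ, colAt] using h

/-- The conjugate embedding, which sends `√2` to the other square root of `2`. -/
noncomputable def conjHom (φ : ℤ√2 →+* K) : ℤ√2 →+* K := φ.comp (starRingEnd (ℤ√2))

lemma conjHom_injective (hφ : Function.Injective φ) : Function.Injective (conjHom φ) :=
  hφ.comp star_injective

lemma conjHom_sqrtd : conjHom φ ⟨0, 1⟩ = -φ ⟨0, 1⟩ := by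
  rw [conjHom, ← map_neg]
  rfl

/-- The arrangement over `ψ` has `τ = -√2`. -/
lemma crossRatioEq_eval (ψ : ℤ√2 →+* K) :
    crossRatioEq (-ψ ⟨0, 1⟩) (fun i => (line33 i).eval ψ) = 0 := by
  have h : ∀ a b c d : ℤ√2,
      a * b - (-⟨0, 1⟩ - 1) * (c * d) = 0 → ψ a * ψ b - (-ψ ⟨0, 1⟩ - 1) * (ψ c * ψ d) = 0 := by
    intro a b c d h
    have := congrArg ψ h
    simpa only [map_sub, map_mul, map_neg, map_one, map_zero] using this
  simp only [crossRatioEq, bracket_eval]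
  exact h _ _ _ _ (by decide +kernel)

/-- Two realizations with the same cross ratio are projectively equivalent. -/
lemma realization_equiv [CharZero K] (hφ : Function.Injective φ)
    {R R' : Realization (points φ lines33)} {ψ : ℤ√2 →+* K} (hψ : Function.Injective ψ)
    (h : crossRatioEq (-ψ ⟨0, 1⟩) (colAt hφ R) = 0)
    (h' : crossRatioEq (-ψ ⟨0, 1⟩) (colAt hφ R') = 0) : R ≈ R' := by
  obtain ⟨g, hg⟩ :=
    (sameIncidences_colAt hφ R).exists_eq_smul hψ h (crossRatioEq_eval ψ)
  obtain ⟨g', hg'⟩ :=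
    (sameIncidences_colAt hφ R').exists_eq_smul hψ h' (crossRatioEq_eval ψ)
  have key : ∀ l, ∃ t : Kˣ, R'.col l = (t : K) • (g' * g⁻¹).1.mulVec (R.col l) := by
    intro l
    obtain ⟨i, rfl⟩ := lineAt_surjective hφ l
    obtain ⟨t, ht⟩ := hg i
    obtain ⟨t', ht'⟩ := hg' i
    rw [colAt] at ht ht'
    refine ⟨t' * t⁻¹, ?_⟩
    rw [ht, ht', Matrix.mulVec_smul, Matrix.mulVec_mulVec, smul_smul, ← Units.val_mul,
      ← Units.val_mul]
    simp [mul_assoc]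
  choose t ht using key
  exact ⟨g' * g⁻¹, t, ht⟩

/-- A realization has the cross ratio of the arrangement or of its conjugate. -/
lemma crossRatioEq_or [CharZero K] (hφ : Function.Injective φ)
    (R : Realization (points φ lines33)) :
    crossRatioEq (φ ⟨0, 1⟩) (colAt hφ R) = 0 ∨ crossRatioEq (-φ ⟨0, 1⟩) (colAt hφ R) = 0 := by
  obtain ⟨-, -, -, -, -, x, y, -, -, h, hr⟩ :=
    (sameIncidences_colAt hφ R).exists_normal_form
  have hs : φ ⟨0, 1⟩ ^ 2 = 2 := by
    rw [← map_pow, show (⟨0, 1⟩ : ℤ√2) ^ 2 = 2 by ext <;> simp [pow_two], map_ofNat]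
  rw [hr, hr, ← sub_eq_zero, ← sub_eq_zero (b := -φ ⟨0, 1⟩ * y), ← mul_eq_zero]
  linear_combination h - y ^ 2 * hs

lemma not_crossRatioEq_and [CharZero K] (hφ : Function.Injective φ)
    (R : Realization (points φ lines33)) :
    ¬ (crossRatioEq (φ ⟨0, 1⟩) (colAt hφ R) = 0 ∧ crossRatioEq (-φ ⟨0, 1⟩) (colAt hφ R) = 0) := by
  obtain ⟨-, -, -, -, -, x, y, hy, -, -, hr⟩ :=
    (sameIncidences_colAt hφ R).exists_normal_form
  rw [hr, hr]
  rintro ⟨h1, h2⟩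
  have h3 : φ ⟨0, 1⟩ * (2 * y) = 0 := by linear_combination h2 - h1
  have h4 : φ ⟨0, 1⟩ ≠ 0 := by
    rw [Ne, map_eq_zero_iff φ hφ]
    decide
  simp [h4, hy] at h3

lemma crossRatioEq_of_equiv [CharZero K] (hφ : Function.Injective φ)
    {R R' : Realization (points φ lines33)} (h : R ≈ R') {τ : K}
    (hR : crossRatioEq τ (colAt hφ R) = 0) : crossRatioEq τ (colAt hφ R') = 0 := by
  obtain ⟨g, t, ht⟩ := h
  simp only [crossRatioEq, colAt, ht, bracket_smul, bracket_mulVec] at hR ⊢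
  linear_combination (g.1.det ^ 2 * t (lineAt hφ 7) * t (lineAt hφ 1) * t (lineAt hφ 2) ^ 2 *
    t (lineAt hφ 3) * t (lineAt hφ 0)) * hR

open MvPolynomial in
/-- The condition on the cross ratio is closed in the Zariski topology. -/
lemma isClosed_crossRatioEq (hφ : Function.Injective φ) (τ : K) :
    IsClosed {R : Realization (points φ lines33) | crossRatioEq τ (colAt hφ R) = 0} := by
  let x (i : Fin 33) (j : Fin 3) : MvPolynomial (points φ lines33 × Fin 3) K :=
    X (lineAt hφ i, j)
  let br (i j k : Fin 33) : MvPolynomial (points φ lines33 × Fin 3) K :=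
    x i 0 * (x j 1 * x k 2 - x j 2 * x k 1) + x i 1 * (x j 2 * x k 0 - x j 0 * x k 2) +
      x i 2 * (x j 0 * x k 1 - x j 1 * x k 0)
  let F := br 7 1 2 * br 3 0 2 - (C τ - 1) * (br 7 0 2 * br 3 1 2)
  rw [isClosed_induced_iff]
  refine ⟨PrimeSpectrum.zeroLocus {F}, PrimeSpectrum.isClosed_zeroLocus _, ?_⟩
  ext R
  rw [Set.mem_preimage, PrimeSpectrum.mem_zeroLocus, Set.singleton_subset_iff]
  have hmem : ∀ x : points φ lines33 × Fin 3 → K,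
      F ∈ (pointToPoint x : PrimeSpectrum (MvPolynomial _ K)).asIdeal ↔ aeval x F = 0 := by
    intro x
    simp [pointToPoint]
  refine (hmem _).trans ?_
  simp [F, br, x, crossRatioEq, bracket, colAt]

/-- The rigidity of the arrangement: up to equivalence there are at most two realizations, and the
cross ratio separates them by closed conditions. -/
theorem isRigid_lines33 [CharZero K] (hφ : Function.Injective φ) :
    IsRigid (points φ lines33) := by
  have hne : Nonempty (Realization (points φ lines33)) :=
    ⟨⟨fun l => l.1.rep, fun _ _ _ => Iff.rfl⟩⟩
  have hopen : ∀ τ : K, τ = φ ⟨0, 1⟩ ∨ τ = -φ ⟨0, 1⟩ →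
      IsOpen {R : Realization (points φ lines33) | crossRatioEq τ (colAt hφ R) = 0} := by
    have hor := crossRatioEq_or hφ
    have hand := not_crossRatioEq_and hφ
    rintro τ (rfl | rfl)
    · convert (isClosed_crossRatioEq hφ (-φ ⟨0, 1⟩)).isOpen_compl using 1
      ext R
      have h1 := hor R
      have h2 := hand R
      simp only [Set.mem_ofPred_eq, Set.mem_compl_iff]
      tauto
    · convert (isClosed_crossRatioEq hφ (φ ⟨0, 1⟩)).isOpen_compl using 1
      ext R
      have h1 := hor R
      have h2 := hand R
      simp only [Set.mem_ofPred_eq, Set.mem_compl_iff]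
      tauto
  have hclass : ∀ R : Realization (points φ lines33), ∃ τ : K, (τ = φ ⟨0, 1⟩ ∨ τ = -φ ⟨0, 1⟩) ∧
      ∀ R', R' ≈ R ↔ crossRatioEq τ (colAt hφ R') = 0 := by
    intro R
    rcases crossRatioEq_or hφ R with h | h
    · refine ⟨_, Or.inl rfl, fun R' => ⟨fun h' => crossRatioEq_of_equiv hφ (Setoid.symm h') h,
        fun h' => realization_equiv hφ (conjHom_injective hφ) ?_ ?_⟩⟩
      · rwa [conjHom_sqrtd, neg_neg]
      · rwa [conjHom_sqrtd, neg_neg]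
    · exact ⟨_, Or.inr rfl, fun R' => ⟨fun h' => crossRatioEq_of_equiv hφ (Setoid.symm h') h,
        fun h' => realization_equiv hφ hφ h' h⟩⟩
  have hdisc : DiscreteTopology (ModuliSpace (points φ lines33)) := by
    rw [discreteTopology_iff_isOpen_singleton]
    intro q
    induction q using Quotient.inductionOn with | _ R
    obtain ⟨τ, hτ, h⟩ := hclass R
    rw [← isQuotientMap_quotient_mk'.isOpen_preimage]
    convert hopen τ hτ using 1
    ext R'
    rw [Set.mem_preimage, Set.mem_singleton_iff, Set.mem_ofPred_eq, ← h]
    exact Quotient.eq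
  refine le_antisymm (topologicalKrullDim_zero_of_discreteTopology _) ?_
  obtain ⟨R⟩ := hne
  have : Nonempty (TopologicalSpace.IrreducibleCloseds (ModuliSpace (points φ lines33))) :=
    ⟨⟨closure {⟦R⟧}, isIrreducible_singleton.closure, isClosed_closure⟩⟩
  exact Order.krullDim_nonneg

end Rigid

/-! ### Conclusion -/

lemma numPoints_lines33_eq {K : Type*} [Field K] {φ : ℤ√2 →+* K} (hφ : Function.Injective φ)
    {k : ℕ} (hk : 2 ≤ k) :
    numPoints (points φ lines33) k =
      ((if k = 2 then 108 else 0) + (if k = 3 then 40 else 0) + (if k = 5 then 16 else 0) +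
        (if k = 8 then 5 else 0) : ℕ) := by
  rw [numPoints_lines33 hφ hk, map_mult_points169]
  simp only [List.count_append, List.count_replicate, beq_iff_eq, @eq_comm ℕ k]

end LineArrangement

theorem theoremB :
    ∃ O : Set (LineArrangement.Plane ℝ),
      O = LineArrangement.pointLineOp {2} (Set.Ici 3) (LineArrangement.polygonLines 8) ∧
      LineArrangement.complexify O =
        LineArrangement.pointLineOp {2} (Set.Ici 3)
          (LineArrangement.complexify (LineArrangement.polygonLines 8)) ∧
      O.encard = 33 ∧
      LineArrangement.numPoints O 2 = 108 ∧
      LineArrangement.numPoints O 3 = 40 ∧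
      LineArrangement.numPoints O 5 = 16 ∧
      LineArrangement.numPoints O 8 = 5 ∧
      (∀ k : ℕ, 2 ≤ k → k ≠ 2 → k ≠ 3 → k ≠ 5 → k ≠ 8 → LineArrangement.numPoints O k = 0) ∧
      LineArrangement.IsRigid (LineArrangement.complexify O) ∧
      LineArrangement.IsFree (LineArrangement.complexify O) 15 17 := by
  open LineArrangement in
  refine ⟨points realHom lines33, ?_, ?_, ?_, ?_, ?_, ?_, ?_, fun k hk h2 h3 h5 h8 => ?_, ?_, ?_⟩
  · rw [polygonLines_eight, pointLineOp_octagonLines realHom_injective]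
  · rw [polygonLines_eight, complexify_points, complexify_points,
      pointLineOp_octagonLines complexHom_injective]
  · rw [encard_points realHom_injective reduced_lines33]
    rfl
  · rw [numPoints_lines33_eq realHom_injective le_rfl]
    rfl
  · rw [numPoints_lines33_eq realHom_injective (by norm_num)]
    rfl
  · rw [numPoints_lines33_eq realHom_injective (by norm_num)]
    rfl
  · rw [numPoints_lines33_eq realHom_injective (by norm_num)]
    rfl
  · rw [numPoints_lines33_eq realHom_injective hk]
    simp [h2, h3, h5, h8]
  · rw [complexify_points]
    exact isRigid_lines33 complexHom_injective
  · rw [complexify_points]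
    exact isFree_lines33 complexHom_injective
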